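/- Let $d\ge 2$ and $m>0$. Put $\omega_{\mathbf p}=(\mathbf p^2+m^2)^{1/2}$, $H_m^+=\{(\omega_{\mathbf p},\mathbf p):\mathbf p\in\mathbb R^{d-1}\}$, $d\mu(p)=d^{d-1}\mathbf p/\omega_{\mathbf p}$, and let $\mathcal H=\bigoplus_{n\ge 0}\mathcal H_n$ be the Bosonic Fock space over $\mathcal H_1=L^2(H_m^+,d\mu)$, so that $\mathcal H_n$ consists of the symmetric functions in $L^2((H_m^+)^n,d\mu^{\times n})$. Let $\Omega$ be the vacuum vector and let $\mathcal D\subset\mathcal H$ be the subspace of vectors of finite particle number. Let $Q$ be a real antisymmetric $(d\times d)$-matrix, and write $p\cdot x=p^0x^0-\sum_k p^kx^k$ and $pQp'=p_\mu Q^{\mu\nu}p'_\nu$. For $f\in\mathscr S(\mathbb R^d)$ put $f^{\pm}(p)=\int d^dx\,f(x)e^{\pm ip\cdot x}$, $p\in H_m^+$, and $$\phi(Q,f)=a^*(Q,f^+)+a(Q,f^-),$$ where, on their natural domains (all $\Psi\in\mathcal H$ for which the right-hand sides exist and define a vector of $\mathcal H$), $$(a(Q,g)\Psi)_n(q_1,\dots,q_n)=\sqrt{n+1}\int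 d\mu(p)\,g(p)\,e^{\frac i2 pQ(q_1+\dots+q_n)}\,\Psi_{n+1}(p,q_1,\dots,q_n),$$ $$(a^*(Q,g)\Psi)_n(q_1,\dots,q_n)=\frac1{\sqrt n}\sum_{k=1}^n g(q_k)\,e^{-\frac i2 q_kQ(q_1+\dots+q_n)}\,\Psi_{n-1}(q_1,\dots,\widehat{q_k},\dots,q_n)\quad(n\ge1),\qquad (a^*(Q,g)\Psi)_0=0.$$ (These are the smeared versions of $a(Q,p)=e^{\frac i2pQP}a(p)$ and $a^*(Q,p)=e^{-\frac i2pQP}a^*(p)$, where $P$ is the energy-momentum operator and $a(p),a^*(p)$ are the canonical annihilation and creation operators.) Then: 1. $\mathcal D$ is dense in $\mathcal H$, and for every $f\in\mathscr S(\mathbb R^d)$ it is contained in the domain of $\phi(Q,f)$ and $\phi(Q,f)\mathcal D\subset\mathcal D$. 2. For every $\Psi\in\mathcal D$, the map $f\mapsto\phi(Q,f)\Psi$ is a vector-valued tempered distribution, i.e. a continuous linear map $\mathscr S(\mathbb R^d)\to\mathcal H$. 3. For every $f\in\mathscr S(\mathbb R^d)$ and $\Psi\in\mathcal D$, $\Psi$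 lies in the domain of $\phi(Q,f)^*$ and $\phi(Q,f)^*\Psi=\phi(Q,\overline f)\Psi$. If $f$ is real, $\phi(Q,f)$ is essentially self-adjoint on $\mathcal D$. 4. (Reeh–Schlieder property) For every non-empty open set $\mathcal O\subset\mathbb R^d$, the linear span of the vectors $\phi(Q,f_1)\cdots\phi(Q,f_n)\Omega$, with $n\ge0$ and $f_1,\dots,f_n\in\mathscr S(\mathbb R^d)$ supported in $\mathcal O$, is dense in $\mathcal H$. -/

import Mathlib

open MeasureTheory
open scoped SchwartzMap InnerProductSpace

namespace TwistedField

noncomputable section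

/-- `d`-dimensional Minkowski space `ℝ^d`, `d = s + 1`; the coordinate `0` is time. -/
abbrev Spacetime (s : ℕ) : Type := EuclideanSpace ℝ (Fin (s + 1))

/-- Spatial momenta; they are the global coordinates `p ↦ (ω_p, p)` on the upper mass shell. -/
abbrev Momentum (s : ℕ) : Type := EuclideanSpace ℝ (Fin s)

/-- Minkowski product `p · x = p⁰ x⁰ - ∑ pᵏ xᵏ`. -/
def mdot {s : ℕ} (p x : Spacetime s) : ℝ := p 0 * x 0 - ∑ k : Fin s, p k.succ * x k.succ

/-- Covariant components `p_μ` of a vector with components `p^μ`. -/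
def lower {s : ℕ} (p : Spacetime s) : Fin (s + 1) → ℝ :=
  Fin.cons (p 0) (fun k : Fin s => -p k.succ)

/-- `p Q p' = p_μ Q^{μν} p'_ν`. -/
def twist {s : ℕ} (Q : Matrix (Fin (s + 1)) (Fin (s + 1)) ℝ) (p p' : Spacetime s) : ℝ :=
  ∑ μ, ∑ ν, lower p μ * Q μ ν * lower p' ν

/-- The energy `ω_p = (p² + m²)^{1/2}`. -/
def energy (m : ℝ) {s : ℕ} (p : Momentum s) : ℝ := Real.sqrt (‖p‖ ^ 2 + m ^ 2)

/-- The point `(ω_p, p)` of the upper mass shell. -/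
def shell (m : ℝ) {s : ℕ} (p : Momentum s) : Spacetime s :=
  WithLp.toLp 2 (Fin.cons (energy m p) (fun k : Fin s => p k))

/-- The Lorentz invariant measure `dμ(p) = d^s p / ω_p`. -/
def shellMeasure (m : ℝ) (s : ℕ) : Measure (Momentum s) :=
  volume.withDensity (fun p => ENNReal.ofReal (energy m p)⁻¹)

instance (m : ℝ) (s : ℕ) : SigmaFinite (shellMeasure m s) := by
  unfold shellMeasure
  exact SigmaFinite.withDensity_of_ne_top (Filter.Eventually.of_forall fun _ => ENNReal.ofReal_ne_top)

/-- The product measure on `n`-tuples of on-shell momenta. -/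
def shellMeasurePi (m : ℝ) (s n : ℕ) : Measure (Fin n → Momentum s) :=
  Measure.pi (fun _ => shellMeasure m s)

theorem measurePreserving_perm (m : ℝ) (s n : ℕ) (σ : Equiv.Perm (Fin n)) :
    MeasurePreserving (fun q : Fin n → Momentum s => fun j => q (σ j))
      (shellMeasurePi m s n) (shellMeasurePi m s n) := by
  have h := measurePreserving_piCongrLeft (fun _ : Fin n => shellMeasure m s) σ⁻¹
  convert h using 1
  swap; · rfl
  swap; · rfl
  funext q j
  have := MeasurableEquiv.piCongrLeft_apply_apply (β := fun _ : Fin n => Momentum s) σ⁻¹ q (σ j)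
  simpa using this.symm

/-- The `n`-particle space: the totally symmetric functions in `L²` of the `n`-fold product of the
mass shell. For `n = 0` this is `ℂ`. -/
def nParticle (m : ℝ) (s n : ℕ) : Submodule ℂ (Lp ℂ 2 (shellMeasurePi m s n)) where
  carrier := {Ψ | ∀ σ : Equiv.Perm (Fin n),
    Lp.compMeasurePreserving _ (measurePreserving_perm m s n σ) Ψ = Ψ}
  add_mem' := by
    intro a b ha hb σ
    rw [map_add, ha σ, hb σ]
  zero_mem' := by
    intro σ
    exact map_zero _
  smul_mem' := by
    intro c a ha σ
    have := (Lp.compMeasurePreservingₗ (E := ℂ) (p := 2) ℂ _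
      (measurePreserving_perm m s n σ)).map_smul c a
    exact this.trans (congrArg (fun x => c • x) (ha σ))

theorem isClosed_nParticle (m : ℝ) (s n : ℕ) :
    IsClosed (nParticle m s n : Set (Lp ℂ 2 (shellMeasurePi m s n))) := by
  have : (nParticle m s n : Set (Lp ℂ 2 (shellMeasurePi m s n))) =
      ⋂ σ : Equiv.Perm (Fin n), {Ψ | Lp.compMeasurePreserving _
        (measurePreserving_perm m s n σ) Ψ = Ψ} := by
    ext Ψ
    rw [Set.mem_iInter]
    rfl
  rw [this]
  exact isClosed_iInter fun σ =>
    isClosed_eq (Lp.isometry_compMeasurePreserving _).continuous continuous_id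

instance (m : ℝ) (s n : ℕ) : CompleteSpace (nParticle m s n) :=
  (isClosed_nParticle m s n).completeSpace_coe

/-- The Bosonic Fock space `⨁ₙ ℋₙ` (Hilbert space direct sum). -/
abbrev Fock (m : ℝ) (s : ℕ) : Type := lp (fun n : ℕ => nParticle m s n) 2

/-- The `n`-particle wave function `Ψₙ(q₁, …, qₙ)` of `Ψ`. -/
def wave {m : ℝ} {s : ℕ} (Ψ : Fock m s) (n : ℕ) : (Fin n → Momentum s) → ℂ :=
  ((Ψ n : nParticle m s n) : Lp ℂ 2 (shellMeasurePi m s n))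

theorem memLp_one_zero (m : ℝ) (s : ℕ) :
    MemLp (fun _ : Fin 0 → Momentum s => (1 : ℂ)) 2 (shellMeasurePi m s 0) := by
  have : IsFiniteMeasure (shellMeasurePi m s 0) := by
    unfold shellMeasurePi
    rw [Measure.pi_of_empty]
    infer_instance
  exact memLp_const 1

/-- The vacuum vector `Ω = (1, 0, 0, …)`. -/
def vacuum (m : ℝ) (s : ℕ) : Fock m s :=
  lp.single 2 0 ⟨(memLp_one_zero m s).toLp _, by
    intro σ
    exact Lp.toLp_compMeasurePreserving (memLp_one_zero m s) (measurePreserving_perm m s 0 σ)⟩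

/-- The subspace `𝒟` of vectors of finite particle number. -/
def finiteParticle (m : ℝ) (s : ℕ) : Submodule ℂ (Fock m s) where
  carrier := {Ψ | ∃ N : ℕ, ∀ n, N ≤ n → Ψ n = 0}
  add_mem' := by
    rintro a b ⟨N, hN⟩ ⟨M, hM⟩
    refine ⟨max N M, fun n hn => ?_⟩
    have h1 := hN n (le_trans (le_max_left _ _) hn)
    have h2 := hM n (le_trans (le_max_right _ _) hn)
    simp [h1, h2]
  zero_mem' := ⟨0, fun n _ => by simp⟩
  smul_mem' := by
    rintro c a ⟨N, hN⟩
    exact ⟨N, fun n hn => by simp [hN n hn]⟩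

theorem wave_add {m : ℝ} {s : ℕ} (Ψ Φ : Fock m s) (n : ℕ) :
    wave (Ψ + Φ) n =ᵐ[shellMeasurePi m s n] wave Ψ n + wave Φ n :=
  Lp.coeFn_add _ _

theorem wave_smul {m : ℝ} {s : ℕ} (c : ℂ) (Ψ : Fock m s) (n : ℕ) :
    wave (c • Ψ) n =ᵐ[shellMeasurePi m s n] c • wave Ψ n :=
  Lp.coeFn_smul _ _

theorem wave_zero {m : ℝ} {s : ℕ} (n : ℕ) :
    wave (0 : Fock m s) n =ᵐ[shellMeasurePi m s n] 0 :=
  Lp.coeFn_zero _ _ _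

theorem eq_zero_of_wave {m : ℝ} {s : ℕ} {Ψ : Fock m s}
    (h : ∀ n, wave Ψ n =ᵐ[shellMeasurePi m s n] 0) : Ψ = 0 := by
  ext1
  funext n
  apply Subtype.ext
  exact (Lp.eq_zero_iff_ae_eq_zero).2 (h n)

/-- Almost every `n`-tuple property holds after removing one entry of almost every
`(n+1)`-tuple. -/
theorem ae_remove {m : ℝ} {s n : ℕ} (k : Fin (n + 1)) {P : (Fin n → Momentum s) → Prop}
    (h : ∀ᵐ q ∂shellMeasurePi m s n, P q) :
    ∀ᵐ q ∂shellMeasurePi m s (n + 1), P (fun j => q (k.succAbove j)) := by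
  have h1 := measurePreserving_piFinSuccAbove (fun _ : Fin (n + 1) => shellMeasure m s) k
  have h2 := (Measure.quasiMeasurePreserving_snd (μ := shellMeasure m s)
    (ν := shellMeasurePi m s n)).ae h
  exact h1.quasiMeasurePreserving.ae h2

/-- Fubini for null sets, first entry separated. -/
theorem ae_cons {m : ℝ} {s n : ℕ} {P : (Fin (n + 1) → Momentum s) → Prop}
    (h : ∀ᵐ q ∂shellMeasurePi m s (n + 1), P q) :
    ∀ᵐ q ∂shellMeasurePi m s n, ∀ᵐ p ∂shellMeasure m s, P (Fin.cons p q) := by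
  have : SigmaFinite (shellMeasurePi m s n) := by
    unfold shellMeasurePi; infer_instance
  have h1 := (measurePreserving_piFinSuccAbove (fun _ : Fin (n + 1) => shellMeasure m s) 0).symm
  have h2 := h1.quasiMeasurePreserving.ae h
  have h3 := (Measure.measurePreserving_swap (μ := shellMeasurePi m s n)
    (ν := shellMeasure m s)).quasiMeasurePreserving.ae h2
  have h4 := Measure.ae_ae_of_ae_prod h3
  filter_upwards [h4] with q hq
  filter_upwards [hq] with p hp
  simpa [MeasurableEquiv.piFinSuccAbove, Fin.consEquiv, Fin.insertNthEquiv] using hp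

/-- Total momentum `∑ q_l` of an `n`-tuple of on-shell momenta: the value of the energy-momentum
operators `P` at `(q₁, …, qₙ)`. -/
def totalMomentum (m : ℝ) {s n : ℕ} (q : Fin n → Momentum s) : Spacetime s :=
  ∑ l, shell m (q l)

/-- The `n`-particle component of `a*(Q, g)Ψ = ∫ dμ(p) g(p) e^{-(i/2) p Q P} a*(p) Ψ`:
`(a*(Q, g)Ψ)₀ = 0` and `(a*(Q, g)Ψ)ₙ₊₁(q) = (n+1)^{-1/2} ∑ₖ g(qₖ) e^{-(i/2) qₖ Q ∑ₗ qₗ}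
Ψₙ(q₀, …, q̂ₖ, …, qₙ)`. -/
def creationWave {m : ℝ} {s : ℕ} (Q : Matrix (Fin (s + 1)) (Fin (s + 1)) ℝ)
    (g : Momentum s → ℂ) (Ψ : Fock m s) : (n : ℕ) → (Fin n → Momentum s) → ℂ
  | 0, _ => 0
  | n + 1, q => ((Real.sqrt (n + 1))⁻¹ : ℝ) * ∑ k : Fin (n + 1),
      g (q k) * Complex.exp (-(Complex.I / 2) * (twist Q (shell m (q k)) (totalMomentum m q) : ℝ)) *
        wave Ψ n (fun j => q (k.succAbove j))

/-- The integrand of `(a(Q, g)Ψ)ₙ(q)`, without the factor `(n+1)^{1/2}`. -/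
def annihilationIntegrand {m : ℝ} {s : ℕ} (Q : Matrix (Fin (s + 1)) (Fin (s + 1)) ℝ)
    (g : Momentum s → ℂ) (Ψ : Fock m s) (n : ℕ) (q : Fin n → Momentum s) (p : Momentum s) : ℂ :=
  g p * Complex.exp ((Complex.I / 2) * (twist Q (shell m p) (totalMomentum m q) : ℝ)) *
    wave Ψ (n + 1) (Fin.cons p q)

/-- The `n`-particle component of `a(Q, g)Ψ = ∫ dμ(p) g(p) e^{(i/2) p Q P} a(p) Ψ`:
`(a(Q, g)Ψ)ₙ(q) = (n+1)^{1/2} ∫ dμ(p) g(p) e^{(i/2) p Q ∑ₗ qₗ} Ψₙ₊₁(p, q₁, …, qₙ)`. -/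
def annihilationWave {m : ℝ} {s : ℕ} (Q : Matrix (Fin (s + 1)) (Fin (s + 1)) ℝ)
    (g : Momentum s → ℂ) (Ψ : Fock m s) (n : ℕ) (q : Fin n → Momentum s) : ℂ :=
  (Real.sqrt (n + 1) : ℝ) * ∫ p, annihilationIntegrand Q g Ψ n q p ∂shellMeasure m s

/-- The graph of `a*(Q, g)` on its maximal domain. -/
def creationGraph (m : ℝ) {s : ℕ} (Q : Matrix (Fin (s + 1)) (Fin (s + 1)) ℝ)
    (g : Momentum s → ℂ) : Submodule ℂ (Fock m s × Fock m s) where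
  carrier := {x | ∀ n, wave x.2 n =ᵐ[shellMeasurePi m s n] creationWave Q g x.1 n}
  add_mem' := by
    rintro ⟨a, a'⟩ ⟨b, b'⟩ ha hb n
    have hadd := wave_add a' b' n
    have h1 := ha n
    have h2 := hb n
    cases n with
    | zero =>
      filter_upwards [hadd, h1, h2] with q e e1 e2
      simp only [Prod.snd_add, Prod.fst_add] at *
      rw [e, Pi.add_apply, e1, e2]
      simp [creationWave]
    | succ n =>
      have h3 : ∀ᵐ q ∂shellMeasurePi m s (n + 1), ∀ k : Fin (n + 1),
          wave (a + b) n (fun j => q (k.succAbove j)) =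
            wave a n (fun j => q (k.succAbove j)) + wave b n (fun j => q (k.succAbove j)) :=
        ae_all_iff.2 fun k => ae_remove k (wave_add a b n)
      filter_upwards [hadd, h1, h2, h3] with q e e1 e2 e3
      simp only [Prod.snd_add, Prod.fst_add] at *
      rw [e, Pi.add_apply, e1, e2]
      simp only [creationWave, e3, mul_add, Finset.sum_add_distrib]
  zero_mem' := by
    intro n
    cases n with
    | zero =>
      filter_upwards [wave_zero (m := m) (s := s) 0] with q e
      simpa [creationWave] using e
    | succ n =>
      have h3 : ∀ᵐ q ∂shellMeasurePi m s (n + 1), ∀ k : Fin (n + 1),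
          wave (0 : Fock m s) n (fun j => q (k.succAbove j)) = 0 :=
        ae_all_iff.2 fun k => ae_remove k (wave_zero n)
      filter_upwards [wave_zero (m := m) (s := s) (n + 1), h3] with q e e3
      simp only [Prod.snd_zero, Prod.fst_zero] at *
      rw [e]
      simp [creationWave, e3]
  smul_mem' := by
    rintro c ⟨a, a'⟩ ha n
    have hs := wave_smul c a' n
    have h1 := ha n
    cases n with
    | zero =>
      filter_upwards [hs, h1] with q e e1
      simp only [Prod.smul_snd, Prod.smul_fst] at *
      rw [e, Pi.smul_apply, e1]
      simp [creationWave]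
    | succ n =>
      have h3 : ∀ᵐ q ∂shellMeasurePi m s (n + 1), ∀ k : Fin (n + 1),
          wave (c • a) n (fun j => q (k.succAbove j)) =
            c * wave a n (fun j => q (k.succAbove j)) :=
        ae_all_iff.2 fun k => ae_remove k (wave_smul c a n)
      filter_upwards [hs, h1, h3] with q e e1 e3
      simp only [Prod.smul_snd, Prod.smul_fst] at *
      rw [e, Pi.smul_apply, e1]
      simp only [creationWave, e3, smul_eq_mul, Finset.mul_sum]
      refine Finset.sum_congr rfl fun k _ => ?_
      ring

/-- The graph of `a(Q, g)` on its maximal domain: the integral is required to converge. -/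
def annihilationGraph (m : ℝ) {s : ℕ} (Q : Matrix (Fin (s + 1)) (Fin (s + 1)) ℝ)
    (g : Momentum s → ℂ) : Submodule ℂ (Fock m s × Fock m s) where
  carrier := {x | ∀ n,
    (∀ᵐ q ∂shellMeasurePi m s n,
      Integrable (annihilationIntegrand Q g x.1 n q) (shellMeasure m s)) ∧
    wave x.2 n =ᵐ[shellMeasurePi m s n] annihilationWave Q g x.1 n}
  add_mem' := by
    rintro ⟨a, a'⟩ ⟨b, b'⟩ ha hb n
    have key : ∀ᵐ q ∂shellMeasurePi m s n,
        annihilationIntegrand Q g (a + b) n q =ᵐ[shellMeasure m s]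
          annihilationIntegrand Q g a n q + annihilationIntegrand Q g b n q := by
      filter_upwards [ae_cons (wave_add a b (n + 1))] with q hq
      filter_upwards [hq] with p hp
      simp only [annihilationIntegrand, hp, Pi.add_apply, mul_add]
    constructor
    · filter_upwards [key, (ha n).1, (hb n).1] with q hq h1 h2
      exact (h1.add h2).congr hq.symm
    · filter_upwards [key, (ha n).1, (hb n).1, (ha n).2, (hb n).2, wave_add a' b' n]
        with q hq h1 h2 e1 e2 e
      simp only [Prod.snd_add, Prod.fst_add] at *
      rw [e, Pi.add_apply, e1, e2]
      simp only [annihilationWave]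
      rw [integral_congr_ae hq, integral_add' h1 h2, mul_add]
  zero_mem' := by
    intro n
    have key : ∀ᵐ q ∂shellMeasurePi m s n,
        annihilationIntegrand Q g (0 : Fock m s) n q =ᵐ[shellMeasure m s] 0 := by
      filter_upwards [ae_cons (wave_zero (m := m) (s := s) (n + 1))] with q hq
      filter_upwards [hq] with p hp
      simp [annihilationIntegrand, hp]
    constructor
    · filter_upwards [key] with q hq
      exact (integrable_zero _ _ _).congr hq.symm
    · filter_upwards [key, wave_zero (m := m) (s := s) n] with q hq e
      simp only [Prod.snd_zero, Prod.fst_zero] at *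
      rw [e]
      simp only [annihilationWave]
      rw [integral_congr_ae hq]
      simp
  smul_mem' := by
    rintro c ⟨a, a'⟩ ha n
    have key : ∀ᵐ q ∂shellMeasurePi m s n,
        annihilationIntegrand Q g (c • a) n q =ᵐ[shellMeasure m s]
          c • annihilationIntegrand Q g a n q := by
      filter_upwards [ae_cons (wave_smul c a (n + 1))] with q hq
      filter_upwards [hq] with p hp
      simp only [annihilationIntegrand, hp, Pi.smul_apply, smul_eq_mul]
      ring
    constructor
    · filter_upwards [key, (ha n).1] with q hq h1
      exact (h1.smul c).congr hq.symm
    · filter_upwards [key, (ha n).2, wave_smul c a' n] with q hq e1 e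
      simp only [Prod.smul_snd, Prod.smul_fst] at *
      rw [e, Pi.smul_apply, e1]
      simp only [annihilationWave]
      rw [integral_congr_ae hq]
      have hc : ∫ p, (c • annihilationIntegrand Q g a n q) p ∂shellMeasure m s =
          c • ∫ p, annihilationIntegrand Q g a n q p ∂shellMeasure m s := integral_const_mul c _
      rw [hc]
      simp only [smul_eq_mul]
      ring

/-- The operator `a*(Q, g)`; its domain is the set of all `Ψ` for which the right-hand side in
`creationWave` is again a Fock space vector. -/
def creation (m : ℝ) {s : ℕ} (Q : Matrix (Fin (s + 1)) (Fin (s + 1)) ℝ) (g : Momentum s → ℂ) :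
    Fock m s →ₗ.[ℂ] Fock m s :=
  (creationGraph m Q g).toLinearPMap

/-- The operator `a(Q, g)`; its domain is the set of all `Ψ` for which the right-hand side in
`annihilationWave` is again a Fock space vector. -/
def annihilation (m : ℝ) {s : ℕ} (Q : Matrix (Fin (s + 1)) (Fin (s + 1)) ℝ)
    (g : Momentum s → ℂ) : Fock m s →ₗ.[ℂ] Fock m s :=
  (annihilationGraph m Q g).toLinearPMap

theorem graph_creation (m : ℝ) {s : ℕ} (Q : Matrix (Fin (s + 1)) (Fin (s + 1)) ℝ)
    (g : Momentum s → ℂ) : (creation m Q g).graph = creationGraph m Q g := by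
  refine Submodule.toLinearPMap_graph_eq _ ?_
  rintro ⟨a, b⟩ h (rfl : a = 0)
  refine eq_zero_of_wave fun n => ?_
  have h0 := (creationGraph m Q g).zero_mem n
  exact (h n).trans (h0.symm.trans (wave_zero n))

theorem graph_annihilation (m : ℝ) {s : ℕ} (Q : Matrix (Fin (s + 1)) (Fin (s + 1)) ℝ)
    (g : Momentum s → ℂ) : (annihilation m Q g).graph = annihilationGraph m Q g := by
  refine Submodule.toLinearPMap_graph_eq _ ?_
  rintro ⟨a, b⟩ h (rfl : a = 0)
  refine eq_zero_of_wave fun n => ?_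
  have h0 := ((annihilationGraph m Q g).zero_mem n).2
  exact (h n).2.trans (h0.symm.trans (wave_zero n))

/-- `f⁺(p) = ∫ f(x) e^{i p·x} dx`, `p` on the upper mass shell. -/
def testPlus (m : ℝ) {s : ℕ} (f : 𝓢(Spacetime s, ℂ)) (p : Momentum s) : ℂ :=
  ∫ x, f x * Complex.exp (Complex.I * (mdot (shell m p) x : ℝ))

/-- `f⁻(p) = ∫ f(x) e^{-i p·x} dx`, `p` on the upper mass shell. -/
def testMinus (m : ℝ) {s : ℕ} (f : 𝓢(Spacetime s, ℂ)) (p : Momentum s) : ℂ :=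
  ∫ x, f x * Complex.exp (-Complex.I * (mdot (shell m p) x : ℝ))

/-- The smeared field `φ(Q, f) = a*(Q, f⁺) + a(Q, f⁻)`, with domain
`dom a*(Q, f⁺) ∩ dom a(Q, f⁻)`. -/
def field (m : ℝ) {s : ℕ} (Q : Matrix (Fin (s + 1)) (Fin (s + 1)) ℝ) (f : 𝓢(Spacetime s, ℂ)) :
    Fock m s →ₗ.[ℂ] Fock m s :=
  creation m Q (testPlus m f) + annihilation m Q (testMinus m f)

/-- The complex conjugate of a test function. -/
def conjTest {s : ℕ} (f : 𝓢(Spacetime s, ℂ)) : 𝓢(Spacetime s, ℂ) :=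
  f.postcompCLM (𝕜 := ℝ) (Complex.conjCLE : ℂ →L[ℝ] ℂ)

theorem conjTest_apply {s : ℕ} (f : 𝓢(Spacetime s, ℂ)) (x : Spacetime s) :
    conjTest f x = (starRingEnd ℂ) (f x) := rfl

/-- `T` is essentially self-adjoint on `D`: `D ⊆ dom T`, and the restriction of `T` to `D` is
closable with self-adjoint closure (in particular it is densely defined). -/
def EssentiallySelfAdjointOn {H : Type*} [NormedAddCommGroup H] [InnerProductSpace ℂ H]
    [CompleteSpace H] (T : H →ₗ.[ℂ] H) (D : Submodule ℂ H) : Prop :=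
  D ≤ T.domain ∧ (T.domRestrict D).IsClosable ∧ IsSelfAdjoint (T.domRestrict D).closure

/-- The vectors `φ(Q, f₁) ⋯ φ(Q, fₙ) Ω`, `n ≥ 0`, with test functions supported in `O`. -/
inductive IsFieldMonomial (m : ℝ) {s : ℕ} (Q : Matrix (Fin (s + 1)) (Fin (s + 1)) ℝ)
    (O : Set (Spacetime s)) : Fock m s → Prop
  | vacuum : IsFieldMonomial m Q O (vacuum m s)
  | apply (f : 𝓢(Spacetime s, ℂ)) (hf : tsupport f ⊆ O) (Ψ : (field m Q f).domain)
      (hΨ : IsFieldMonomial m Q O (Ψ : Fock m s)) : IsFieldMonomial m Q O (field m Q f Ψ)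

end

end TwistedField

open TwistedField

/-! For `g` in `L²`, the operators `a*(Q, g)` and `a(Q, g)` move the particle number by one, and
between fixed degrees they are bounded with norm at most `√(n+1) ‖g‖`: the twist only inserts phases
of modulus one. Antisymmetry of `Q` gives `p Q p = 0`. Hence the creation phase, built with the
total momentum including `p`, is conjugate to the annihilation phase, built with the other momenta,
and the blocks are mutually adjoint up to conjugation of `g`. So `φ(Q, f)` acts as a band operator
(`IsBandImage`), and the claims on the domain, invariance and adjoint on `𝒟` follow degree by
degree. Continuity in `f` holds because `f ↦ f±` is a rescaled Fourier transform restricted to the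
mass shell, continuous into Schwartz functions and hence into `L²`.

Essential self-adjointness is obtained by averaging truncations. If `w` lies in the domain of the
adjoint, then the adjoint's value is the band image of `w`. Cutting `w` off at degree `M` creates
two boundary terms, whose norms are bounded by multiples of `√M` times single components of `w`.
These need not tend to zero, but they are orthogonal for different `M`, so the sum of the first `N`
has norm of order `√N` and their Cesàro means vanish. Thus the graph of the adjoint lies in the
closure of the graph (`IsBandImage.mem_topologicalClosure`).

Reeh–Schlieder is an induction on the particle number (`eq_zero_of_forall_inner_monomial`). If `Φ`
is orthogonal to the monomials and has no components up to degree `n`, pairing it with `φ(Q, f)Ψ`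
sees only the top degree, and `a(Q, conj f⁺)Φₙ₊₁` satisfies the hypothesis in degree `n`. It
therefore vanishes for all `f` localized in `O`, and the one-particle case
(`eq_zero_of_forall_inner_testPlusL`) extends this to all `g`, which forces `Φₙ₊₁ = 0`. In the
one-particle case translations of `f` turn orthogonality into the local vanishing of a Fourier
transform on the mass shell. Positivity of the energy continues it to imaginary time
(`laplace_eq_zero`); the resulting factor `e^{-τω}` makes the spatial transform analytic, so it
vanishes everywhere, and Fourier uniqueness concludes. -/

namespace TwistedField

noncomputable section

open Filter Topology

/-! ### A graph criterion for essential self-adjointness. -/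

section EssentialSelfAdjointness

variable {E : Type*} [NormedAddCommGroup E] [InnerProductSpace ℂ E] [CompleteSpace E]

/-- A densely defined symmetric operator whose closure extends its adjoint is closable with
self-adjoint closure. -/
theorem isClosable_and_isSelfAdjoint_closure {A : E →ₗ.[ℂ] E} (hd : Dense (A.domain : Set E))
    (hsymm : A.IsFormalAdjoint A)
    (hcl : A.adjoint.graph ≤ A.graph.topologicalClosure) :
    A.IsClosable ∧ IsSelfAdjoint A.closure := by
  have hle : A ≤ A.adjoint := hsymm.le_adjoint hd
  have hclosed : A.adjoint.IsClosed := LinearPMap.adjoint_isClosed hd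
  have hclosable : A.IsClosable := hclosed.isClosable.leIsClosable hle
  have hgraph : A.graph.topologicalClosure = A.adjoint.graph :=
    le_antisymm (Submodule.topologicalClosure_minimal _ (LinearPMap.le_graph_of_le hle) hclosed) hcl
  have heq : A.closure = A.adjoint := by
    apply LinearPMap.eq_of_eq_graph
    rw [← hclosable.graph_closure_eq_closure_graph, hgraph]
  refine ⟨hclosable, ?_⟩
  rw [heq, LinearPMap.isSelfAdjoint_def]
  have hd' : Dense (A.adjoint.domain : Set E) := hd.mono hle.1
  -- `A ≤ A†` gives `A†† ≤ A†`. The reverse inclusion is the symmetry of `A†`: for fixed `x` the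
  -- defining relation is closed in the pair `z`, so it passes from the graph of `A` to its closure,
  -- the graph of `A†`.
  refine le_antisymm (LinearPMap.IsFormalAdjoint.le_adjoint hd ?_)
    (LinearPMap.IsFormalAdjoint.le_adjoint hd' ?_)
  · intro x y
    rw [hle.2 (show (x : E) = (⟨x, hle.1 x.2⟩ : A.adjoint.domain) from rfl)]
    exact (LinearPMap.adjoint_isFormalAdjoint hd').symm ⟨x, hle.1 x.2⟩ y
  · intro x y
    have hc : _root_.IsClosed {z : E × E | ⟪A.adjoint x, z.1⟫_ℂ = ⟪(x : E), z.2⟫_ℂ} :=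
      isClosed_eq (by fun_prop) (by fun_prop)
    have hsub : (A.graph : Set (E × E)) ⊆ {z : E × E | ⟪A.adjoint x, z.1⟫_ℂ = ⟪(x : E), z.2⟫_ℂ} := by
      rintro ⟨z, z'⟩ hz
      obtain ⟨w, rfl, rfl⟩ := (LinearPMap.mem_graph_iff _).1 hz
      exact LinearPMap.adjoint_isFormalAdjoint hd x w
    have hy : ((y : E), A.adjoint y) ∈ A.graph.topologicalClosure := by
      rw [hgraph]; exact LinearPMap.mem_graph _ y
    exact closure_minimal hsub hc hy

end EssentialSelfAdjointness

/-! ### Cesàro means of truncations for band operators on a Hilbert sum. -/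

section Band

variable {H : ℕ → Type*} [∀ n, NormedAddCommGroup (H n)]

theorem norm_sum_single_le (f : ∀ n, H n) (N : ℕ) {b : ℝ} (hb : 0 ≤ b)
    (h : ∑ n ∈ Finset.range N, ‖f n‖ ^ 2 ≤ b ^ 2) :
    ‖∑ n ∈ Finset.range N, lp.single 2 n (f n)‖ ≤ b := by
  have h2 := lp.norm_sum_single (p := 2) (by norm_num) f (Finset.range N)
  simp only [ENNReal.toReal_ofNat, Real.rpow_ofNat] at h2
  exact (sq_le_sq₀ (norm_nonneg _) hb).1 (h2.trans_le h)

theorem sum_norm_sq_le (Ψ : lp H 2) (s : Finset ℕ) : ∑ n ∈ s, ‖Ψ n‖ ^ 2 ≤ ‖Ψ‖ ^ 2 := by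
  have h := lp.sum_rpow_le_norm_rpow (p := 2) (by norm_num) Ψ s
  simpa only [ENNReal.toReal_ofNat, Real.rpow_ofNat] using h

variable [∀ n, InnerProductSpace ℂ (H n)]

/-- `Φ` is the image of `Ψ` under the operator on the Hilbert sum `⨁ₙ Hₙ` with raising
components `C n` and lowering components `A n`. -/
def IsBandImage (C : ∀ n, H n →L[ℂ] H (n + 1)) (A : ∀ n, H (n + 1) →L[ℂ] H n)
    (Ψ Φ : lp H 2) : Prop :=
  Φ 0 = A 0 (Ψ 1) ∧ ∀ n, Φ (n + 1) = C n (Ψ n) + A (n + 1) (Ψ (n + 2))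

theorem inner_eq_sum_range {Ψ : lp H 2} {N : ℕ} (hΨ : ∀ n, N ≤ n → Ψ n = 0) (Φ : lp H 2) :
    ⟪Ψ, Φ⟫_ℂ = ∑ n ∈ Finset.range N, ⟪Ψ n, Φ n⟫_ℂ := by
  rw [lp.inner_eq_tsum]
  refine tsum_eq_sum fun n hn => ?_
  rw [hΨ n (by simpa using hn), inner_zero_left]

/-- The summands lie in different degrees, so their squared norms add. The triangle inequality with
Cauchy–Schwarz would only give order `N`, too much for the averaging argument. -/
theorem norm_sum_lower_le {A : ∀ n, H (n + 1) →L[ℂ] H n} {c : ℝ} (hc : 0 ≤ c)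
    (hA : ∀ n x, ‖A n x‖ ≤ c * √(n + 1) * ‖x‖) (Ψ : lp H 2) (N : ℕ) :
    ‖∑ n ∈ Finset.range N, lp.single (E := H) 2 n (A n (Ψ (n + 1)))‖ ≤ c * √N * ‖Ψ‖ := by
  refine norm_sum_single_le (fun n => A n (Ψ (n + 1))) N (by positivity) ?_
  calc ∑ n ∈ Finset.range N, ‖A n (Ψ (n + 1))‖ ^ 2
      ≤ ∑ n ∈ Finset.range N, (c * √N) ^ 2 * ‖Ψ (n + 1)‖ ^ 2 := by
        refine Finset.sum_le_sum fun n hn => ?_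
        rw [← mul_pow]
        have : (n : ℝ) + 1 ≤ N := by exact_mod_cast Finset.mem_range.1 hn
        gcongr
        exact (hA n _).trans (by gcongr)
    _ = (c * √N) ^ 2 * ∑ n ∈ Finset.range N, ‖Ψ (n + 1)‖ ^ 2 := by rw [Finset.mul_sum]
    _ ≤ (c * √N) ^ 2 * ‖Ψ‖ ^ 2 := by
        gcongr
        have h := sum_norm_sq_le Ψ (Finset.range (N + 1))
        rw [Finset.sum_range_succ'] at h
        nlinarith [sq_nonneg ‖Ψ 0‖]
    _ = _ := by rw [← mul_pow]

theorem norm_sum_raise_le {C : ∀ n, H n →L[ℂ] H (n + 1)} {c : ℝ} (hc : 0 ≤ c)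
    (hC : ∀ n x, ‖C n x‖ ≤ c * √(n + 1) * ‖x‖) (Ψ : lp H 2) (N : ℕ) :
    ‖∑ n ∈ Finset.range N, lp.single (E := H) 2 (n + 1) (C n (Ψ n))‖ ≤ c * √N * ‖Ψ‖ := by
  -- Indexing by the target degree, with zero in degree `0`, makes the Pythagorean estimate
  -- applicable.
  let f : ∀ n, H n := fun n => Nat.casesOn n 0 fun k => C k (Ψ k)
  have hf : ∑ n ∈ Finset.range N, lp.single (E := H) 2 (n + 1) (C n (Ψ n)) =
      ∑ n ∈ Finset.range (N + 1), lp.single 2 n (f n) := by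
    rw [Finset.sum_range_succ']
    simp [f]
  rw [hf]
  refine norm_sum_single_le f (N + 1) (by positivity) ?_
  rw [Finset.sum_range_succ']
  calc ∑ n ∈ Finset.range N, ‖f (n + 1)‖ ^ 2 + ‖f 0‖ ^ 2
      = ∑ n ∈ Finset.range N, ‖C n (Ψ n)‖ ^ 2 := by simp [f]
    _ ≤ ∑ n ∈ Finset.range N, (c * √N) ^ 2 * ‖Ψ n‖ ^ 2 := by
        refine Finset.sum_le_sum fun n hn => ?_
        rw [← mul_pow]
        have : (n : ℝ) + 1 ≤ N := by exact_mod_cast Finset.mem_range.1 hn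
        gcongr
        exact (hC n _).trans (by gcongr)
    _ = (c * √N) ^ 2 * ∑ n ∈ Finset.range N, ‖Ψ n‖ ^ 2 := by rw [Finset.mul_sum]
    _ ≤ (c * √N) ^ 2 * ‖Ψ‖ ^ 2 := by
        gcongr
        exact sum_norm_sq_le Ψ _
    _ = _ := by rw [← mul_pow]

theorem tendsto_inv_smul_of_norm_le_sqrt {F : Type*} [NormedAddCommGroup F] [NormedSpace ℝ F]
    {u : ℕ → F} {b : ℝ} (h : ∀ N : ℕ, ‖u N‖ ≤ b * √N) :
    Tendsto (fun N : ℕ => (N : ℝ)⁻¹ • u N) atTop (𝓝 0) := by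
  have h1 : Tendsto (fun N : ℕ => b * (√(N : ℝ))⁻¹) atTop (𝓝 0) := by
    have : Tendsto (fun N : ℕ => (√(N : ℝ))⁻¹) atTop (𝓝 0) :=
      tendsto_inv_atTop_zero.comp (Real.tendsto_sqrt_atTop.comp tendsto_natCast_atTop_atTop)
    simpa using this.const_mul b
  refine squeeze_zero_norm (fun N => ?_) h1
  rw [norm_smul, norm_inv, Real.norm_natCast]
  calc (N : ℝ)⁻¹ * ‖u N‖ ≤ (N : ℝ)⁻¹ * (b * √N) := by gcongr; exact h N
    _ = b * (√N / N) := by ring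
    _ = b * (√(N : ℝ))⁻¹ := by rw [Real.sqrt_div_self', one_div]

/-- A band operator whose components grow at most like `√n` is contained in the closure of its
restriction to vectors with one non-zero component. -/
theorem IsBandImage.mem_topologicalClosure {C : ∀ n, H n →L[ℂ] H (n + 1)}
    {A : ∀ n, H (n + 1) →L[ℂ] H n} {c : ℝ} (hc : 0 ≤ c)
    (hC : ∀ n x, ‖C n x‖ ≤ c * √(n + 1) * ‖x‖) (hA : ∀ n x, ‖A n x‖ ≤ c * √(n + 1) * ‖x‖)
    {Ψ Φ : lp H 2} (h : IsBandImage C A Ψ Φ) {G : Submodule ℂ (lp H 2 × lp H 2)}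
    (hG0 : ∀ x : H 0, (lp.single 2 0 x, lp.single 2 1 (C 0 x)) ∈ G)
    (hG : ∀ n (x : H (n + 1)), (lp.single 2 (n + 1) x,
      lp.single 2 (n + 2) (C (n + 1) x) + lp.single 2 n (A n x)) ∈ G) :
    (Ψ, Φ) ∈ G.topologicalClosure := by
  -- The operator maps the truncation `P Ψ M` to `P Φ M + R M - S M`: the raised top component `R M`
  -- sticks out in degree `M + 1`, and the contribution `S M` of the discarded component `Ψ (M + 1)`
  -- is missing in degree `M`.
  let P : lp H 2 → ℕ → lp H 2 := fun Ψ M => ∑ n ∈ Finset.range (M + 1), lp.single 2 n (Ψ n)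
  let R : ℕ → lp H 2 := fun M => lp.single 2 (M + 1) (C M (Ψ M))
  let S : ℕ → lp H 2 := fun M => lp.single 2 M (A M (Ψ (M + 1)))
  have hmem : ∀ M, (P Ψ M, P Φ M + R M - S M) ∈ G := by
    intro M
    induction M with
    | zero =>
      have e : P Φ 0 = S 0 := by simp [P, S, h.1]
      rw [e, add_sub_cancel_left]
      simpa [P] using hG0 (Ψ 0)
    | succ M ih =>
      have e1 : P Ψ (M + 1) = P Ψ M + lp.single 2 (M + 1) (Ψ (M + 1)) :=
        Finset.sum_range_succ _ _
      have e2 : P Φ (M + 1) = P Φ M + (R M + S (M + 1)) := by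
        simp only [P, R, S]
        rw [Finset.sum_range_succ _ (M + 1), h.2 M, lp.single_add]
      have e3 := G.add_mem ih (hG M (Ψ (M + 1)))
      rw [e1, e2]
      convert e3 using 1
      refine Prod.ext rfl ?_
      change P Φ M + (R M + S (M + 1)) + R (M + 1) - S (M + 1) =
        P Φ M + R M - S M + (R (M + 1) + S M)
      abel
  have hP : ∀ Ψ : lp H 2, Tendsto (P Ψ) atTop (𝓝 Ψ) := fun Ψ =>
    ((lp.hasSum_single (by norm_num) Ψ).tendsto_sum_nat).comp (tendsto_add_atTop_nat 1)
  -- `R M` and `S M` need not tend to zero one by one; only their averages do.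
  have hR : Tendsto (fun N : ℕ => (N : ℝ)⁻¹ • ∑ M ∈ Finset.range N, R M) atTop (𝓝 0) :=
    tendsto_inv_smul_of_norm_le_sqrt (b := c * ‖Ψ‖) fun N =>
      (norm_sum_raise_le hc hC Ψ N).trans_eq (by ring)
  have hS : Tendsto (fun N : ℕ => (N : ℝ)⁻¹ • ∑ M ∈ Finset.range N, S M) atTop (𝓝 0) :=
    tendsto_inv_smul_of_norm_le_sqrt (b := c * ‖Ψ‖) fun N =>
      (norm_sum_lower_le hc hA Ψ N).trans_eq (by ring)
  have h2 : Tendsto (fun N : ℕ => (N : ℝ)⁻¹ • ∑ M ∈ Finset.range N, (P Φ M + R M - S M)) atTop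
      (𝓝 Φ) := by
    have := ((hP Φ).cesaro_smul.add hR).sub hS
    simp only [add_zero, sub_zero] at this
    refine this.congr fun N => ?_
    rw [Finset.sum_sub_distrib, Finset.sum_add_distrib, smul_sub, smul_add]
  refine mem_closure_of_tendsto ((hP Ψ).cesaro_smul.prodMk_nhds h2)
    (Eventually.of_forall fun N => ?_)
  have h3 := G.smul_mem ((N : ℂ)⁻¹) (G.sum_mem (t := Finset.range N) fun M _ => hmem M)
  -- The means use real scalars, whereas `G` is a complex subspace.
  have hN : ∀ x : lp H 2, (N : ℝ)⁻¹ • x = ((N : ℂ)⁻¹) • x := fun x => by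
    ext n
    simp only [lp.coeFn_smul, Pi.smul_apply]
    rw [← Complex.coe_smul]
    simp
  have e : ((N : ℂ)⁻¹) • ∑ M ∈ Finset.range N, (P Ψ M, P Φ M + R M - S M) =
      ((N : ℝ)⁻¹ • ∑ M ∈ Finset.range N, P Ψ M,
        (N : ℝ)⁻¹ • ∑ M ∈ Finset.range N, (P Φ M + R M - S M)) := by
    refine Prod.ext ?_ ?_
    · simp only [hN, Prod.smul_fst, Prod.fst_sum]
    · simp only [hN, Prod.smul_snd, Prod.snd_sum]
  rwa [e] at h3

end Band

/-! ### Pointwise conjugation and the norm on `L²`. -/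

section LpStar

variable {α : Type*} [MeasurableSpace α] {μ : Measure α}

theorem Lp_star_add (f g : Lp ℂ 2 μ) : star (f + g) = star f + star g := by
  apply Lp.ext
  filter_upwards [Lp.coeFn_star (f + g), Lp.coeFn_star f, Lp.coeFn_star g, Lp.coeFn_add f g,
    Lp.coeFn_add (star f) (star g)] with x h1 h2 h3 h4 h5
  rw [h1, h5, Pi.add_apply, h2, h3, Pi.star_apply, h4, Pi.add_apply, star_add]
  rfl

theorem Lp_star_smul (c : ℂ) (f : Lp ℂ 2 μ) : star (c • f) = (starRingEnd ℂ) c • star f := by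
  apply Lp.ext
  filter_upwards [Lp.coeFn_star (c • f), Lp.coeFn_star f, Lp.coeFn_smul c f,
    Lp.coeFn_smul ((starRingEnd ℂ) c) (star f)] with x h1 h2 h3 h4
  simp [h1, h2, h3, h4]

theorem norm_Lp_star (f : Lp ℂ 2 μ) : ‖star f‖ = ‖f‖ := by
  rw [Lp.norm_def, Lp.norm_def]
  congr 1
  refine eLpNorm_congr_norm_ae ?_
  filter_upwards [Lp.coeFn_star f] with x hx
  simp [hx]

theorem norm_sq_Lp_eq_integral (f : Lp ℂ 2 μ) : ‖f‖ ^ 2 = ∫ x, ‖f x‖ ^ 2 ∂μ := by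
  have h := L2.inner_def (𝕜 := ℂ) f f
  rw [inner_self_eq_norm_sq_to_K] at h
  have h2 : ∫ a, ⟪f a, f a⟫_ℂ ∂μ = ((∫ x, ‖f x‖ ^ 2 ∂μ : ℝ) : ℂ) := by
    refine Eq.trans ?_ (integral_ofReal (𝕜 := ℂ))
    refine integral_congr_ae (Eventually.of_forall fun x => ?_)
    simp only [inner_self_eq_norm_sq_to_K]
    push_cast
    rfl
  rw [h2] at h
  apply Complex.ofReal_injective
  rw [← h]
  push_cast
  rfl

end LpStar

/-! ### Tensoring with a phase, its adjoint, and totality of the products. -/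

section Tensor

variable {α β : Type*} [MeasurableSpace α] [MeasurableSpace β] {μ : Measure α} {ν : Measure β}
  {θ : α × β → ℂ}

theorem aestronglyMeasurable_tensor (hθ : Measurable θ) (g : Lp ℂ 2 μ) (ψ : Lp ℂ 2 ν) :
    AEStronglyMeasurable (fun x : α × β => g x.1 * θ x * ψ x.2) (μ.prod ν) :=
  ((Lp.aestronglyMeasurable g).comp_fst.mul hθ.aestronglyMeasurable).mul
    (Lp.aestronglyMeasurable ψ).comp_snd

theorem norm_sq_tensor (hθ1 : ∀ x, ‖θ x‖ = 1) (g : Lp ℂ 2 μ) (ψ : Lp ℂ 2 ν) (x : α × β) :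
    ‖g x.1 * θ x * ψ x.2‖ ^ 2 = ‖g x.1‖ ^ 2 * ‖ψ x.2‖ ^ 2 := by
  rw [norm_mul, norm_mul, hθ1, mul_one, mul_pow]

theorem memLp_tensor (hθ : Measurable θ) (hθ1 : ∀ x, ‖θ x‖ = 1) (g : Lp ℂ 2 μ) (ψ : Lp ℂ 2 ν) :
    MemLp (fun x : α × β => g x.1 * θ x * ψ x.2) 2 (μ.prod ν) := by
  rw [memLp_two_iff_integrable_sq_norm (aestronglyMeasurable_tensor hθ g ψ)]
  simp only [norm_sq_tensor hθ1]
  exact ((memLp_two_iff_integrable_sq_norm (Lp.aestronglyMeasurable g)).1 (Lp.memLp g)).mul_prod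
    ((memLp_two_iff_integrable_sq_norm (Lp.aestronglyMeasurable ψ)).1 (Lp.memLp ψ))

variable [SigmaFinite μ] [SigmaFinite ν]

/-- The function `(x, y) ↦ g x * θ (x, y) * ψ y`, for a phase `θ`, as a bounded bilinear map on
`L²` spaces. -/
def tensor (hθ : Measurable θ) (hθ1 : ∀ x, ‖θ x‖ = 1) :
    Lp ℂ 2 μ →L[ℂ] Lp ℂ 2 ν →L[ℂ] Lp ℂ 2 (μ.prod ν) :=
  LinearMap.mkContinuous₂
    (LinearMap.mk₂ ℂ (fun g ψ => (memLp_tensor hθ hθ1 g ψ).toLp _)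
      (fun g g' ψ => by
        rw [← MemLp.toLp_add]
        refine MemLp.toLp_congr _ _ ?_
        filter_upwards [Measure.quasiMeasurePreserving_fst.ae (Lp.coeFn_add g g')] with x hx
        simp only [hx, Pi.add_apply]
        ring)
      (fun c g ψ => by
        rw [← MemLp.toLp_const_smul]
        refine MemLp.toLp_congr _ _ ?_
        filter_upwards [Measure.quasiMeasurePreserving_fst.ae (Lp.coeFn_smul c g)] with x hx
        simp only [hx, Pi.smul_apply, smul_eq_mul]
        ring)
      (fun g ψ ψ' => by
        rw [← MemLp.toLp_add]
        refine MemLp.toLp_congr _ _ ?_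
        filter_upwards [Measure.quasiMeasurePreserving_snd.ae (Lp.coeFn_add ψ ψ')] with x hx
        simp only [hx, Pi.add_apply]
        ring)
      (fun c g ψ => by
        rw [← MemLp.toLp_const_smul]
        refine MemLp.toLp_congr _ _ ?_
        filter_upwards [Measure.quasiMeasurePreserving_snd.ae (Lp.coeFn_smul c ψ)] with x hx
        simp only [hx, Pi.smul_apply, smul_eq_mul]
        ring))
    1 (fun g ψ => by
      simp only [LinearMap.mk₂_apply, one_mul]
      refine (sq_le_sq₀ (norm_nonneg _) (by positivity)).1 ?_
      rw [mul_pow, norm_sq_Lp_eq_integral, norm_sq_Lp_eq_integral, norm_sq_Lp_eq_integral,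
        ← integral_prod_mul]
      refine (integral_congr_ae ?_).le
      filter_upwards [MemLp.coeFn_toLp (memLp_tensor hθ hθ1 g ψ)] with x hx
      rw [hx, norm_sq_tensor hθ1])

theorem coeFn_tensor (hθ : Measurable θ) (hθ1 : ∀ x, ‖θ x‖ = 1) (g : Lp ℂ 2 μ) (ψ : Lp ℂ 2 ν) :
    tensor hθ hθ1 g ψ =ᵐ[μ.prod ν] fun x => g x.1 * θ x * ψ x.2 :=
  MemLp.coeFn_toLp (memLp_tensor hθ hθ1 g ψ)

theorem norm_tensor_le (hθ : Measurable θ) (hθ1 : ∀ x, ‖θ x‖ = 1) (g : Lp ℂ 2 μ)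
    (ψ : Lp ℂ 2 ν) : ‖tensor hθ hθ1 g ψ‖ ≤ ‖g‖ * ‖ψ‖ := by
  have h1 : ‖tensor (μ := μ) (ν := ν) hθ hθ1‖ ≤ 1 :=
    LinearMap.mkContinuous₂_norm_le _ zero_le_one _
  calc ‖tensor hθ hθ1 g ψ‖ ≤ ‖tensor hθ hθ1 g‖ * ‖ψ‖ := ContinuousLinearMap.le_opNorm _ _
    _ ≤ (1 * ‖g‖) * ‖ψ‖ := by
        gcongr
        exact (ContinuousLinearMap.le_opNorm _ _).trans (by gcongr)
    _ = _ := by rw [one_mul]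

/-- The slice functional `y ↦ ∫ conj (g x θ(x, y)) F(x, y) dμ(x)` is the adjoint of
`ψ ↦ tensor g ψ`. -/
theorem adjoint_tensor (hθ : Measurable θ) (hθ1 : ∀ x, ‖θ x‖ = 1) (g : Lp ℂ 2 μ)
    (F : Lp ℂ 2 (μ.prod ν)) :
    (∀ᵐ y ∂ν, Integrable (fun x => (starRingEnd ℂ) (g x * θ (x, y)) * F (x, y)) μ) ∧
    ContinuousLinearMap.adjoint (tensor (ν := ν) hθ hθ1 g) F =ᵐ[ν]
      fun y => ∫ x, (starRingEnd ℂ) (g x * θ (x, y)) * F (x, y) ∂μ := by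
  let G : α × β → ℂ := fun x => (starRingEnd ℂ) (g x.1 * θ x) * F x
  -- Pairing `F` with `tensor g 1_S` yields integrability of `G` over `univ ×ˢ S` for `S` of finite
  -- measure, which is what Fubini needs; `G` need not be integrable on the whole product.
  have key : ∀ (S : Set β) (hS : MeasurableSet S) (hS' : ν S ≠ ⊤),
      IntegrableOn G (Set.univ ×ˢ S) (μ.prod ν) ∧
      ∫ y in S, ContinuousLinearMap.adjoint (tensor (ν := ν) hθ hθ1 g) F y ∂ν =
        ∫ x in Set.univ ×ˢ S, G x ∂(μ.prod ν) := by
    intro S hS hS'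
    have hi := L2.integrable_inner (𝕜 := ℂ)
      (tensor hθ hθ1 g (indicatorConstLp 2 hS hS' (1 : ℂ))) F
    have he : (fun x => ⟪tensor hθ hθ1 g (indicatorConstLp 2 hS hS' (1 : ℂ)) x, F x⟫_ℂ)
        =ᵐ[μ.prod ν] (Set.univ ×ˢ S).indicator G := by
      filter_upwards [coeFn_tensor hθ hθ1 g (indicatorConstLp 2 hS hS' (1 : ℂ)),
        Measure.quasiMeasurePreserving_snd.ae
          (indicatorConstLp_coeFn (p := 2) (hs := hS) (hμs := hS') (c := (1 : ℂ)))] with x h1 h2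
      rw [h1, h2]
      by_cases hx : x.2 ∈ S
      · simp [hx, G, Set.indicator, mul_comm, mul_left_comm]
      · simp [hx, Set.indicator]
    have hm : MeasurableSet ((Set.univ : Set α) ×ˢ S) := MeasurableSet.univ.prod hS
    refine ⟨(integrable_indicator_iff hm).1 (hi.congr he), ?_⟩
    rw [← L2.inner_indicatorConstLp_one (𝕜 := ℂ) hS hS', ContinuousLinearMap.adjoint_inner_right,
      L2.inner_def, integral_congr_ae he, integral_indicator hm]
  have hprod : ∀ S : Set β, (μ.prod ν).restrict (Set.univ ×ˢ S) = μ.prod (ν.restrict S) := by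
    intro S
    rw [← Measure.prod_restrict, Measure.restrict_univ]
  constructor
  · have h : ∀ᵐ y ∂ν, ∀ k, y ∈ spanningSets ν k → Integrable (fun x => G (x, y)) μ := by
      refine ae_all_iff.2 fun k => ?_
      have h1 := (key (spanningSets ν k) (measurableSet_spanningSets ν k)
        (measure_spanningSets_lt_top ν k).ne).1
      rw [IntegrableOn, hprod] at h1
      exact (ae_restrict_iff' (measurableSet_spanningSets ν k)).1 h1.prod_left_ae
    filter_upwards [h] with y hy
    exact hy _ (mem_spanningSetsIndex ν y)
  · refine ae_eq_of_forall_setIntegral_eq_of_sigmaFinite ?_ ?_ ?_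
    · intro S hS hS'
      exact integrableOn_Lp_of_measure_ne_top _ (by norm_num) hS'.ne
    · intro S hS hS'
      have h1 := (key S hS hS'.ne).1
      rw [IntegrableOn, hprod] at h1
      exact h1.integral_prod_right
    · intro S hS hS'
      obtain ⟨h1, h2⟩ := key S hS hS'.ne
      rw [IntegrableOn, hprod] at h1
      rw [h2, hprod, integral_prod_symm _ h1]

/-- A π-λ argument inside a rectangle of finite measure: the sets with vanishing integral include
the rectangles and are stable under complements, because the total integral is zero, and under
disjoint unions. A countable exhaustion then covers the product. -/
theorem ae_eq_zero_of_forall_rectangle {F : α × β → ℂ}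
    (hF : ∀ S T, MeasurableSet S → MeasurableSet T → μ S < ⊤ → ν T < ⊤ →
      IntegrableOn F (S ×ˢ T) (μ.prod ν) ∧ ∫ x in S ×ˢ T, F x ∂(μ.prod ν) = 0) :
    F =ᵐ[μ.prod ν] 0 := by
  have hrect : ∀ S₀ T₀, MeasurableSet S₀ → MeasurableSet T₀ → μ S₀ < ⊤ → ν T₀ < ⊤ →
      ∀ᵐ x ∂(μ.prod ν), x ∈ S₀ ×ˢ T₀ → F x = 0 := by
    intro S₀ T₀ hS₀ hT₀ hS₀' hT₀'
    have hI : Integrable F ((μ.prod ν).restrict (S₀ ×ˢ T₀)) := (hF S₀ T₀ hS₀ hT₀ hS₀' hT₀').1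
    have hall : ∀ R : Set (α × β), MeasurableSet R →
        ∫ x in R, F x ∂((μ.prod ν).restrict (S₀ ×ˢ T₀)) = 0 := by
      intro R hR
      induction R, hR using MeasurableSpace.induction_on_inter generateFrom_prod.symm
        isPiSystem_prod with
      | empty => simp
      | basic R hR =>
        obtain ⟨S, hS, T, hT, rfl⟩ := hR
        rw [Measure.restrict_restrict (MeasurableSet.prod hS hT), Set.prod_inter_prod]
        exact (hF _ _ (MeasurableSet.inter hS hS₀) (MeasurableSet.inter hT hT₀)
          ((measure_mono Set.inter_subset_right).trans_lt hS₀')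
          ((measure_mono Set.inter_subset_right).trans_lt hT₀')).2
      | compl R hR ih =>
        have h1 := integral_add_compl hR hI
        rw [ih, zero_add] at h1
        rw [h1]
        exact (hF S₀ T₀ hS₀ hT₀ hS₀' hT₀').2
      | iUnion f hd hm ih =>
        rw [integral_iUnion hm hd hI.integrableOn]
        simp [ih]
    have h0 := hI.ae_eq_zero_of_forall_setIntegral_eq_zero fun R hR _ => hall R hR
    exact (ae_restrict_iff' (hS₀.prod hT₀)).1 h0
  have h : ∀ᵐ x ∂(μ.prod ν), ∀ j k, x ∈ spanningSets μ j ×ˢ spanningSets ν k → F x = 0 :=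
    ae_all_iff.2 fun j => ae_all_iff.2 fun k =>
      hrect _ _ (measurableSet_spanningSets μ j) (measurableSet_spanningSets ν k)
        (measure_spanningSets_lt_top μ j) (measure_spanningSets_lt_top ν k)
  filter_upwards [h] with x hx
  exact hx _ _ ⟨mem_spanningSetsIndex μ x.1, mem_spanningSetsIndex ν x.2⟩

/-- The vectors `tensor g ψ` are total. -/
theorem eq_zero_of_forall_inner_tensor (hθ : Measurable θ) (hθ1 : ∀ x, ‖θ x‖ = 1)
    (F : Lp ℂ 2 (μ.prod ν)) (hF : ∀ g ψ, ⟪tensor (μ := μ) (ν := ν) hθ hθ1 g ψ, F⟫_ℂ = 0) :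
    F = 0 := by
  have h0 : (fun x => (starRingEnd ℂ) (θ x) * F x) =ᵐ[μ.prod ν] 0 := by
    refine ae_eq_zero_of_forall_rectangle fun S T hS hT hS' hT' => ?_
    let g := indicatorConstLp 2 hS hS'.ne (1 : ℂ)
    let ψ := indicatorConstLp 2 hT hT'.ne (1 : ℂ)
    have he : (fun x => ⟪tensor hθ hθ1 g ψ x, F x⟫_ℂ)
        =ᵐ[μ.prod ν] (S ×ˢ T).indicator fun x => (starRingEnd ℂ) (θ x) * F x := by
      filter_upwards [coeFn_tensor hθ hθ1 g ψ,
        Measure.quasiMeasurePreserving_fst.ae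
          (indicatorConstLp_coeFn (p := 2) (hs := hS) (hμs := hS'.ne) (c := (1 : ℂ))),
        Measure.quasiMeasurePreserving_snd.ae
          (indicatorConstLp_coeFn (p := 2) (hs := hT) (hμs := hT'.ne) (c := (1 : ℂ)))]
        with x h1 h2 h3
      rw [h1, h2, h3]
      by_cases hx : x.1 ∈ S <;> by_cases hx' : x.2 ∈ T <;>
        simp [hx, hx', Set.indicator, mul_comm]
    have hm : MeasurableSet (S ×ˢ T) := hS.prod hT
    have hi := (L2.integrable_inner (𝕜 := ℂ) (tensor hθ hθ1 g ψ) F).congr he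
    refine ⟨(integrable_indicator_iff hm).1 hi, ?_⟩
    rw [← integral_indicator hm, ← integral_congr_ae he, ← L2.inner_def, hF]
  rw [Lp.eq_zero_iff_ae_eq_zero]
  filter_upwards [h0] with x hx
  have hne : (starRingEnd ℂ) (θ x) ≠ 0 := by
    rw [map_ne_zero, ← norm_ne_zero_iff, hθ1]
    exact one_ne_zero
  exact (mul_eq_zero.1 hx).resolve_left hne

end Tensor

/-! ### The creation operator between fixed particle numbers. -/

section Blocks

variable {m : ℝ} {s n : ℕ}

instance (m : ℝ) (s n : ℕ) : SigmaFinite (shellMeasurePi m s n) := by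
  unfold shellMeasurePi; infer_instance

@[fun_prop]
theorem continuous_energy : Continuous (energy m : Momentum s → ℝ) := by
  unfold energy
  fun_prop

@[fun_prop]
theorem continuous_shell : Continuous (shell m : Momentum s → Spacetime s) := by
  refine (PiLp.continuous_toLp 2 _).comp (continuous_pi fun i => ?_)
  refine Fin.cases ?_ (fun k => ?_) i
  · simpa using continuous_energy
  · simp only [Fin.cons_succ]
    fun_prop

@[fun_prop]
theorem continuous_totalMomentum :
    Continuous (totalMomentum m : (Fin n → Momentum s) → Spacetime s) := by
  unfold totalMomentum
  fun_prop

theorem lower_add (p p' : Spacetime s) : lower (p + p') = lower p + lower p' := by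
  funext i
  refine Fin.cases ?_ (fun k => ?_) i
  · simp [lower]
  · simp [lower]
    ring

@[fun_prop]
theorem continuous_lower : Continuous (lower : Spacetime s → _) := by
  refine continuous_pi fun i => ?_
  refine Fin.cases ?_ (fun k => ?_) i
  · simp only [lower, Fin.cons_zero]
    fun_prop
  · simp only [lower, Fin.cons_succ]
    fun_prop

variable (Q : Matrix (Fin (s + 1)) (Fin (s + 1)) ℝ)

theorem continuous_twist :
    Continuous (fun x : Spacetime s × Spacetime s => twist Q x.1 x.2) := by
  unfold twist
  fun_prop

theorem twist_add_right (p p' p'' : Spacetime s) :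
    twist Q p (p' + p'') = twist Q p p' + twist Q p p'' := by
  simp only [twist, lower_add, Pi.add_apply, mul_add, Finset.sum_add_distrib]

theorem twist_self {Q : Matrix (Fin (s + 1)) (Fin (s + 1)) ℝ} (hQ : Q.transpose = -Q)
    (p : Spacetime s) : twist Q p p = 0 := by
  have h : ∀ μ ν, Q ν μ = -Q μ ν := fun μ ν => congrFun (congrFun hQ μ) ν
  have h1 : twist Q p p = -twist Q p p := by
    conv_lhs => unfold twist; rw [Finset.sum_comm]
    unfold twist
    simp only [← Finset.sum_neg_distrib]
    refine Finset.sum_congr rfl fun μ _ => Finset.sum_congr rfl fun ν _ => ?_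
    rw [h μ ν]
    ring
  linarith

theorem totalMomentum_perm (σ : Equiv.Perm (Fin n)) (q : Fin n → Momentum s) :
    totalMomentum m (fun j => q (σ j)) = totalMomentum m q :=
  Equiv.sum_comp σ fun j => shell m (q j)

theorem totalMomentum_succAbove (k : Fin (n + 1)) (q : Fin (n + 1) → Momentum s) :
    shell m (q k) + totalMomentum m (fun j => q (k.succAbove j)) = totalMomentum m q :=
  (Fin.sum_univ_succAbove (fun j => shell m (q j)) k).symm

/-- The phase `e^{-(i/2) p Q (p + ∑ₗ qₗ)}`. -/
def phase (m : ℝ) (n : ℕ) (x : Momentum s × (Fin n → Momentum s)) : ℂ :=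
  Complex.exp (-(Complex.I / 2) *
    (twist Q (shell m x.1) (shell m x.1 + totalMomentum m x.2) : ℝ))

theorem measurable_phase (m : ℝ) (n : ℕ) : Measurable (phase Q m n) := by
  have h : Continuous (phase Q m n) := by
    unfold phase
    have := (continuous_twist Q).comp (f := fun x : Momentum s × (Fin n → Momentum s) =>
      (shell m x.1, shell m x.1 + totalMomentum m x.2)) (by fun_prop)
    simp only [Function.comp_def] at this
    fun_prop
  exact h.measurable

theorem norm_phase (m : ℝ) (n : ℕ) (x : Momentum s × (Fin n → Momentum s)) : ‖phase Q m n x‖ = 1 := by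
  rw [phase, Complex.norm_exp]
  simp

/-- This is where antisymmetry enters: `p Q p = 0` removes `p` from the total momentum in the
creation phase, leaving the conjugate of the annihilation phase. -/
theorem conj_phase {Q : Matrix (Fin (s + 1)) (Fin (s + 1)) ℝ} (hQ : Q.transpose = -Q)
    (p : Momentum s) (q : Fin n → Momentum s) : (starRingEnd ℂ) (phase Q m n (p, q)) =
      Complex.exp ((Complex.I / 2) * (twist Q (shell m p) (totalMomentum m q) : ℝ)) := by
  rw [phase, twist_add_right, twist_self hQ, zero_add, ← Complex.exp_conj]
  congr 1
  simp only [map_mul, map_neg, map_div₀, Complex.conj_I, map_ofNat, Complex.conj_ofReal]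
  ring

/-- Separation of the `k`-th entry. -/
def sepL (m : ℝ) (s : ℕ) {n : ℕ} (k : Fin (n + 1)) :
    Lp ℂ 2 ((shellMeasure m s).prod (shellMeasurePi m s n)) →ₗᵢ[ℂ]
      Lp ℂ 2 (shellMeasurePi m s (n + 1)) :=
  Lp.compMeasurePreservingₗᵢ ℂ _
    (measurePreserving_piFinSuccAbove (fun _ : Fin (n + 1) => shellMeasure m s) k)

theorem coeFn_sepL (k : Fin (n + 1))
    (F : Lp ℂ 2 ((shellMeasure m s).prod (shellMeasurePi m s n))) :
    sepL m s k F =ᵐ[shellMeasurePi m s (n + 1)] fun q => F (q k, fun j => q (k.succAbove j)) :=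
  Lp.coeFn_compMeasurePreserving F
    (measurePreserving_piFinSuccAbove (fun _ : Fin (n + 1) => shellMeasure m s) k)

theorem ae_sep (k : Fin (n + 1)) {P : Momentum s × (Fin n → Momentum s) → Prop}
    (h : ∀ᵐ x ∂(shellMeasure m s).prod (shellMeasurePi m s n), P x) :
    ∀ᵐ q ∂shellMeasurePi m s (n + 1), P (q k, fun j => q (k.succAbove j)) :=
  (measurePreserving_piFinSuccAbove
    (fun _ : Fin (n + 1) => shellMeasure m s) k).quasiMeasurePreserving.ae h

theorem ae_perm (σ : Equiv.Perm (Fin n)) {P : (Fin n → Momentum s) → Prop}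
    (h : ∀ᵐ q ∂shellMeasurePi m s n, P q) :
    ∀ᵐ q ∂shellMeasurePi m s n, P (fun j => q (σ j)) :=
  (measurePreserving_perm m s n σ).quasiMeasurePreserving.ae h

/-- The inverse of the separation of the first entry. -/
def consL (m : ℝ) (s n : ℕ) :
    Lp ℂ 2 (shellMeasurePi m s (n + 1)) →ₗᵢ[ℂ]
      Lp ℂ 2 ((shellMeasure m s).prod (shellMeasurePi m s n)) :=
  Lp.compMeasurePreservingₗᵢ ℂ _
    (measurePreserving_piFinSuccAbove (fun _ : Fin (n + 1) => shellMeasure m s) 0).symm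

theorem piFinSuccAbove_symm_apply (x : Momentum s × (Fin n → Momentum s)) :
    (MeasurableEquiv.piFinSuccAbove (fun _ : Fin (n + 1) => Momentum s) 0).symm x =
      Fin.cons x.1 x.2 := by
  simp [MeasurableEquiv.piFinSuccAbove, Fin.insertNthEquiv]

theorem coeFn_consL (Φ : Lp ℂ 2 (shellMeasurePi m s (n + 1))) :
    consL m s n Φ =ᵐ[(shellMeasure m s).prod (shellMeasurePi m s n)]
      fun x => Φ (Fin.cons x.1 x.2) := by
  refine (Lp.coeFn_compMeasurePreserving Φ (measurePreserving_piFinSuccAbove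
    (fun _ : Fin (n + 1) => shellMeasure m s) 0).symm).trans
    (Eventually.of_forall fun x => ?_)
  simp only [Function.comp_apply]
  rw [piFinSuccAbove_symm_apply]

theorem sepL_zero_consL (Φ : Lp ℂ 2 (shellMeasurePi m s (n + 1))) :
    sepL m s 0 (consL m s n Φ) = Φ := by
  apply Lp.ext
  filter_upwards [coeFn_sepL 0 (consL m s n Φ), ae_sep 0 (coeFn_consL Φ)] with q h1 h2
  rw [h1, h2]
  congr 1
  exact Fin.cons_self_tail q

theorem ae_eq_perm {ψ : Lp ℂ 2 (shellMeasurePi m s n)} (hψ : ψ ∈ nParticle m s n)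
    (σ : Equiv.Perm (Fin n)) :
    ∀ᵐ q ∂shellMeasurePi m s n, ψ (fun j => q (σ j)) = ψ q := by
  have h := Lp.coeFn_compMeasurePreserving ψ (measurePreserving_perm m s n σ)
  rw [hψ σ] at h
  filter_upwards [h] with q hq
  exact hq.symm

theorem mem_nParticle_of_ae {ψ : Lp ℂ 2 (shellMeasurePi m s n)}
    (h : ∀ σ : Equiv.Perm (Fin n), ∀ᵐ q ∂shellMeasurePi m s n, ψ (fun j => q (σ j)) = ψ q) :
    ψ ∈ nParticle m s n := by
  intro σ
  apply Lp.ext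
  exact (Lp.coeFn_compMeasurePreserving ψ (measurePreserving_perm m s n σ)).trans (h σ)

/-- The cycle moving the `k`-th entry to the front leaves a symmetric `Φ` unchanged, so every choice
of separated entry gives the same inner product. -/
theorem inner_sepL (k : Fin (n + 1))
    (F : Lp ℂ 2 ((shellMeasure m s).prod (shellMeasurePi m s n)))
    {Φ : Lp ℂ 2 (shellMeasurePi m s (n + 1))} (hΦ : Φ ∈ nParticle m s (n + 1)) :
    ⟪sepL m s k F, Φ⟫_ℂ = ⟪F, consL m s n Φ⟫_ℂ := by
  have h : sepL m s k (consL m s n Φ) = Φ := by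
    apply Lp.ext
    filter_upwards [coeFn_sepL k (consL m s n Φ), ae_sep k (coeFn_consL Φ),
      ae_eq_perm hΦ k.cycleRange.symm] with q h1 h2 h3
    rw [h1, h2, ← h3]
    congr 1
    exact Fin.cons_removeNth_eq_comp_cycleRange_symm q k
  conv_lhs => rw [← h]
  exact (sepL m s k).inner_map_map _ _

/-- The function `g(p) e^{-(i/2) p Q (p + ∑ₗ qₗ)} ψ(q)`. -/
def twistTensor (m : ℝ) (n : ℕ) :
    Lp ℂ 2 (shellMeasure m s) →L[ℂ] Lp ℂ 2 (shellMeasurePi m s n) →L[ℂ]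
      Lp ℂ 2 ((shellMeasure m s).prod (shellMeasurePi m s n)) :=
  tensor (measurable_phase Q m n) (norm_phase Q m n)

theorem coeFn_twistTensor (g : Lp ℂ 2 (shellMeasure m s)) (ψ : Lp ℂ 2 (shellMeasurePi m s n)) :
    twistTensor Q m n g ψ =ᵐ[(shellMeasure m s).prod (shellMeasurePi m s n)]
      fun x => g x.1 * phase Q m n x * ψ x.2 :=
  coeFn_tensor (measurable_phase Q m n) (norm_phase Q m n) g ψ

theorem norm_twistTensor_le (g : Lp ℂ 2 (shellMeasure m s))
    (ψ : Lp ℂ 2 (shellMeasurePi m s n)) : ‖twistTensor Q m n g ψ‖ ≤ ‖g‖ * ‖ψ‖ :=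
  norm_tensor_le (measurable_phase Q m n) (norm_phase Q m n) g ψ

/-- The phase sees the remaining momenta only through their sum. -/
theorem twistTensor_perm (g : Lp ℂ 2 (shellMeasure m s))
    {ψ : Lp ℂ 2 (shellMeasurePi m s n)} (hψ : ψ ∈ nParticle m s n) (σ : Equiv.Perm (Fin n)) :
    ∀ᵐ x ∂(shellMeasure m s).prod (shellMeasurePi m s n),
      twistTensor Q m n g ψ (x.1, fun j => x.2 (σ j)) = twistTensor Q m n g ψ x := by
  have h := coeFn_twistTensor Q g ψ
  have hp := ((MeasurePreserving.id (shellMeasure m s)).prod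
    (measurePreserving_perm m s n σ)).quasiMeasurePreserving.ae h
  filter_upwards [h, hp, Measure.quasiMeasurePreserving_snd.ae (ae_eq_perm hψ σ)]
    with x h1 h2 h3
  refine h2.trans (Eq.trans ?_ h1.symm)
  simp only [Prod.map, id, phase, totalMomentum_perm, h3]

/-- `σ` maps the complement of `k` bijectively onto the complement of `σ k`; `ρ` is this bijection
in `succAbove` coordinates. -/
theorem exists_perm_succAbove (σ : Equiv.Perm (Fin (n + 1))) (k : Fin (n + 1)) :
    ∃ ρ : Equiv.Perm (Fin n), ∀ j, σ (k.succAbove j) = (σ k).succAbove (ρ j) := by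
  have h : ∀ j, ∃ i, (σ k).succAbove i = σ (k.succAbove j) := fun j =>
    Fin.exists_succAbove_eq (fun h => Fin.succAbove_ne k j (σ.injective h))
  choose r hr using h
  have hinj : Function.Injective r := fun i j hij => by
    have := (hr i).symm.trans ((congrArg _ hij).trans (hr j))
    exact Fin.succAbove_right_injective (σ.injective this)
  exact ⟨Equiv.ofBijective r (Finite.injective_iff_bijective.1 hinj), fun j => (hr j).symm⟩

/-- The component `ℋₙ → ℋₙ₊₁` of `a*(Q, g)`, on not necessarily symmetric functions. -/
def creationL (m : ℝ) (n : ℕ) (g : Lp ℂ 2 (shellMeasure m s)) :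
    Lp ℂ 2 (shellMeasurePi m s n) →ₗ[ℂ] Lp ℂ 2 (shellMeasurePi m s (n + 1)) :=
  (((√(n + 1))⁻¹ : ℝ) : ℂ) • ∑ k : Fin (n + 1),
    (sepL m s k).toLinearMap ∘ₗ (twistTensor Q m n g : _ →ₗ[ℂ] _)

theorem creationL_apply (g : Lp ℂ 2 (shellMeasure m s)) (ψ : Lp ℂ 2 (shellMeasurePi m s n)) :
    creationL Q m n g ψ =
      (((√(n + 1))⁻¹ : ℝ) : ℂ) • ∑ k : Fin (n + 1), sepL m s k (twistTensor Q m n g ψ) := by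
  simp [creationL]

theorem coeFn_creationL_aux (g : Lp ℂ 2 (shellMeasure m s))
    (ψ : Lp ℂ 2 (shellMeasurePi m s n)) :
    creationL Q m n g ψ =ᵐ[shellMeasurePi m s (n + 1)] fun q => (((√(n + 1))⁻¹ : ℝ) : ℂ) *
      ∑ k : Fin (n + 1), twistTensor Q m n g ψ (q k, fun j => q (k.succAbove j)) := by
  rw [creationL_apply]
  have h : ∀ᵐ q ∂shellMeasurePi m s (n + 1), ∀ k : Fin (n + 1),
      sepL m s k (twistTensor Q m n g ψ) q =
        twistTensor Q m n g ψ (q k, fun j => q (k.succAbove j)) :=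
    ae_all_iff.2 fun k => coeFn_sepL k _
  filter_upwards [h, Lp.coeFn_smul (((√(n + 1))⁻¹ : ℝ) : ℂ)
    (∑ k : Fin (n + 1), sepL m s k (twistTensor Q m n g ψ)),
    Lp.coeFn_finsetSum Finset.univ (fun k => sepL m s k (twistTensor Q m n g ψ))] with q h1 h2 h3
  rw [h2, Pi.smul_apply, h3, smul_eq_mul, Finset.sum_apply]
  simp only [h1]

theorem coeFn_creationL (g : Lp ℂ 2 (shellMeasure m s)) (ψ : Lp ℂ 2 (shellMeasurePi m s n)) :
    creationL Q m n g ψ =ᵐ[shellMeasurePi m s (n + 1)] fun q => (((√(n + 1))⁻¹ : ℝ) : ℂ) *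
      ∑ k : Fin (n + 1), g (q k) * Complex.exp
        (-(Complex.I / 2) * (twist Q (shell m (q k)) (totalMomentum m q) : ℝ)) *
          ψ (fun j => q (k.succAbove j)) := by
  have h : ∀ᵐ q ∂shellMeasurePi m s (n + 1), ∀ k : Fin (n + 1), _ :=
    ae_all_iff.2 fun k => ae_sep k (coeFn_twistTensor Q g ψ)
  filter_upwards [coeFn_creationL_aux Q g ψ, h] with q h1 h2
  rw [h1]
  congr 1
  refine Finset.sum_congr rfl fun k _ => (h2 k).trans ?_
  simp only [phase, totalMomentum_succAbove]

/-- A permutation of the entries permutes the summands, up to a reordering of the remaining entries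
that the symmetry of `ψ` absorbs. -/
theorem creationL_mem (g : Lp ℂ 2 (shellMeasure m s)) {ψ : Lp ℂ 2 (shellMeasurePi m s n)}
    (hψ : ψ ∈ nParticle m s n) : creationL Q m n g ψ ∈ nParticle m s (n + 1) := by
  refine mem_nParticle_of_ae fun σ => ?_
  have hρ := fun k => exists_perm_succAbove σ k
  choose ρ hρ using hρ
  have h : ∀ᵐ q ∂shellMeasurePi m s (n + 1), ∀ k : Fin (n + 1), _ :=
    ae_all_iff.2 fun k => ae_sep (σ k) (twistTensor_perm Q g hψ (ρ k))
  filter_upwards [coeFn_creationL_aux Q g ψ, ae_perm σ (coeFn_creationL_aux Q g ψ), h]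
    with q h1 h2 h3
  rw [h1, h2]
  congr 1
  rw [← Equiv.sum_comp σ fun k => twistTensor Q m n g ψ (q k, fun j => q (k.succAbove j))]
  refine Finset.sum_congr rfl fun k _ => ?_
  rw [← h3 k]
  simp only [hρ k]

/-- There are `n + 1` summands, each of norm at most `‖g‖ ‖ψ‖`, against the prefactor `(n +
1)^{-1/2}`. -/
theorem norm_creationL_le (g : Lp ℂ 2 (shellMeasure m s)) (ψ : Lp ℂ 2 (shellMeasurePi m s n)) :
    ‖creationL Q m n g ψ‖ ≤ √(n + 1) * ‖g‖ * ‖ψ‖ := by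
  rw [creationL_apply, norm_smul]
  have h : ‖∑ k : Fin (n + 1), sepL m s k (twistTensor Q m n g ψ)‖ ≤
      (n + 1) * (‖g‖ * ‖ψ‖) := by
    refine (norm_sum_le _ _).trans ?_
    simp only [LinearIsometry.norm_map, Finset.sum_const, Finset.card_univ, Fintype.card_fin,
      nsmul_eq_mul]
    push_cast
    gcongr
    exact norm_twistTensor_le Q g ψ
  have hpos : (0 : ℝ) < √(n + 1) := by positivity
  calc ‖(((√(n + 1))⁻¹ : ℝ) : ℂ)‖ * _ ≤ (√(n + 1))⁻¹ * ((n + 1) * (‖g‖ * ‖ψ‖)) := by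
        rw [Complex.norm_real, Real.norm_of_nonneg (by positivity)]
        gcongr
    _ = (√(n + 1))⁻¹ * ((√(n + 1) * √(n + 1)) * (‖g‖ * ‖ψ‖)) := by
        rw [Real.mul_self_sqrt (by positivity)]
    _ = _ := by field_simp

/-- The component `ℋₙ → ℋₙ₊₁` of `a*(Q, g)`, as a bilinear map. -/
def creationBilin (m : ℝ) (n : ℕ) :
    Lp ℂ 2 (shellMeasure m s) →ₗ[ℂ] nParticle m s n →ₗ[ℂ] nParticle m s (n + 1) :=
  LinearMap.mk₂ ℂ (fun g ψ => ⟨creationL Q m n g ψ, creationL_mem Q g ψ.2⟩)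
    (fun g g' ψ => Subtype.ext (by simp [creationL_apply, Finset.sum_add_distrib]))
    (fun c g ψ => Subtype.ext (by simp [creationL_apply, ← Finset.smul_sum, smul_comm c]))
    (fun g ψ ψ' => Subtype.ext (by simp))
    (fun c g ψ => Subtype.ext (by simp))

theorem norm_creationBilin_le (g : Lp ℂ 2 (shellMeasure m s)) (ψ : nParticle m s n) :
    ‖creationBilin Q m n g ψ‖ ≤ √(n + 1) * ‖g‖ * ‖ψ‖ :=
  norm_creationL_le Q g (ψ : Lp ℂ 2 (shellMeasurePi m s n))

/-- The component `ℋₙ → ℋₙ₊₁` of `a*(Q, g)`. -/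
def creationBlock (m : ℝ) (n : ℕ) :
    Lp ℂ 2 (shellMeasure m s) →L[ℂ] nParticle m s n →L[ℂ] nParticle m s (n + 1) :=
  LinearMap.mkContinuous₂ (creationBilin Q m n) √(n + 1) (norm_creationBilin_le Q)

theorem coe_creationBlock (g : Lp ℂ 2 (shellMeasure m s)) (ψ : nParticle m s n) :
    (creationBlock Q m n g ψ : Lp ℂ 2 (shellMeasurePi m s (n + 1))) = creationL Q m n g ψ := rfl

end Blocks

/-! ### The annihilation operator between fixed particle numbers. -/

section Blocks

variable {m : ℝ} {s n : ℕ} (Q : Matrix (Fin (s + 1)) (Fin (s + 1)) ℝ)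

/-- The component `ℋₙ₊₁ → ℋₙ` of `a(Q, g)`, on not necessarily symmetric functions. -/
def annihilationL (m : ℝ) (n : ℕ) (g : Lp ℂ 2 (shellMeasure m s)) :
    Lp ℂ 2 (shellMeasurePi m s (n + 1)) →ₗ[ℂ] Lp ℂ 2 (shellMeasurePi m s n) :=
  ((√(n + 1) : ℝ) : ℂ) •
    (ContinuousLinearMap.adjoint (twistTensor Q m n (star g)) : _ →ₗ[ℂ] _) ∘ₗ
      (consL m s n).toLinearMap

theorem inner_annihilationL (g : Lp ℂ 2 (shellMeasure m s)) (ψ : Lp ℂ 2 (shellMeasurePi m s n))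
    (Φ : Lp ℂ 2 (shellMeasurePi m s (n + 1))) : ⟪ψ, annihilationL Q m n g Φ⟫_ℂ =
      ((√(n + 1) : ℝ) : ℂ) * ⟪twistTensor Q m n (star g) ψ, consL m s n Φ⟫_ℂ := by
  simp only [annihilationL, LinearMap.smul_apply, inner_smul_right, LinearMap.comp_apply]
  congr 1
  exact ContinuousLinearMap.adjoint_inner_right _ _ _

theorem annihilationL_add (g g' : Lp ℂ 2 (shellMeasure m s)) :
    annihilationL Q m n (g + g') = annihilationL Q m n g + annihilationL Q m n g' := by
  ext1 Φ
  refine ext_inner_left ℂ fun ψ => ?_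
  simp only [LinearMap.add_apply, inner_add_right, inner_annihilationL, Lp_star_add, map_add,
    add_apply, inner_add_left]
  ring

/-- Taking adjoints is conjugate linear, and the `star g` in the definition compensates for it. -/
theorem annihilationL_smul (c : ℂ) (g : Lp ℂ 2 (shellMeasure m s)) :
    annihilationL Q m n (c • g) = c • annihilationL Q m n g := by
  ext1 Φ
  refine ext_inner_left ℂ fun ψ => ?_
  simp only [LinearMap.smul_apply, inner_smul_right, inner_annihilationL, Lp_star_smul, map_smul,
    smul_apply, inner_smul_left, Complex.conj_conj]
  ring

/-- By symmetry of `Φ` the `n + 1` terms coincide, and `(n + 1) / √(n + 1) = √(n + 1)` is the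
prefactor of the annihilation operator. -/
theorem inner_creationL (g : Lp ℂ 2 (shellMeasure m s)) (ψ : Lp ℂ 2 (shellMeasurePi m s n))
    {Φ : Lp ℂ 2 (shellMeasurePi m s (n + 1))} (hΦ : Φ ∈ nParticle m s (n + 1)) :
    ⟪creationL Q m n g ψ, Φ⟫_ℂ = ⟪ψ, annihilationL Q m n (star g) Φ⟫_ℂ := by
  rw [inner_annihilationL, star_star, creationL_apply, inner_smul_left, sum_inner]
  simp only [inner_sepL _ _ hΦ, Finset.sum_const, Finset.card_univ, Fintype.card_fin,
    nsmul_eq_mul, Complex.conj_ofReal]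
  rw [← mul_assoc]
  congr 1
  rw [show (((n + 1 : ℕ) : ℂ)) = ((n + 1 : ℝ) : ℂ) by push_cast; rfl, ← Complex.ofReal_mul]
  congr 1
  have hpos : (0 : ℝ) < √(n + 1) := by positivity
  rw [inv_mul_eq_iff_eq_mul₀ hpos.ne', Real.mul_self_sqrt (by positivity)]

theorem norm_annihilationL_le (g : Lp ℂ 2 (shellMeasure m s))
    (Φ : Lp ℂ 2 (shellMeasurePi m s (n + 1))) :
    ‖annihilationL Q m n g Φ‖ ≤ √(n + 1) * ‖g‖ * ‖Φ‖ := by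
  have e : annihilationL Q m n g Φ = ((√(n + 1) : ℝ) : ℂ) •
    ContinuousLinearMap.adjoint (twistTensor Q m n (star g)) (consL m s n Φ) := rfl
  rw [e, norm_smul, Complex.norm_real, Real.norm_of_nonneg (by positivity), mul_assoc]
  gcongr
  refine (ContinuousLinearMap.le_opNorm _ _).trans ?_
  rw [LinearIsometryEquiv.norm_map]
  refine mul_le_mul ?_ (LinearIsometry.norm_map _ _).le (norm_nonneg _) (norm_nonneg _)
  refine ContinuousLinearMap.opNorm_le_bound _ (norm_nonneg _) fun ψ => ?_
  rw [← norm_Lp_star g]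
  exact norm_twistTensor_le Q (star g) ψ

theorem ae_ae_swap {P : Momentum s × (Fin n → Momentum s) → Prop}
    (h : ∀ᵐ x ∂(shellMeasure m s).prod (shellMeasurePi m s n), P x) :
    ∀ᵐ q ∂shellMeasurePi m s n, ∀ᵐ p ∂shellMeasure m s, P (p, q) :=
  Measure.ae_ae_of_ae_prod ((Measure.measurePreserving_swap (μ := shellMeasurePi m s n)
    (ν := shellMeasure m s)).quasiMeasurePreserving.ae h)

theorem coeFn_annihilationL_aux (g : Lp ℂ 2 (shellMeasure m s))
    (Φ : Lp ℂ 2 (shellMeasurePi m s (n + 1))) :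
    (∀ᵐ q ∂shellMeasurePi m s n, Integrable
      (fun p => g p * (starRingEnd ℂ) (phase Q m n (p, q)) * Φ (Fin.cons p q))
        (shellMeasure m s)) ∧
    annihilationL Q m n g Φ =ᵐ[shellMeasurePi m s n] fun q => ((√(n + 1) : ℝ) : ℂ) *
      ∫ p, g p * (starRingEnd ℂ) (phase Q m n (p, q)) * Φ (Fin.cons p q) ∂shellMeasure m s := by
  obtain ⟨h1, h2⟩ := adjoint_tensor (measurable_phase Q m n) (norm_phase Q m n) (star g) (consL m s n Φ)
  have h3 : ∀ᵐ q ∂shellMeasurePi m s n,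
      (fun p => (starRingEnd ℂ) ((star g : Lp ℂ 2 (shellMeasure m s)) p * phase Q m n (p, q)) *
        consL m s n Φ (p, q)) =ᵐ[shellMeasure m s]
      fun p => g p * (starRingEnd ℂ) (phase Q m n (p, q)) * Φ (Fin.cons p q) := by
    filter_upwards [ae_ae_swap (coeFn_consL Φ)] with q hq
    filter_upwards [hq, Lp.coeFn_star g] with p e1 e2
    rw [e1, e2]
    simp
  constructor
  · filter_upwards [h1, h3] with q e1 e3
    exact e1.congr e3
  · filter_upwards [h2, h3, Lp.coeFn_smul ((√(n + 1) : ℝ) : ℂ) (ContinuousLinearMap.adjoint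
      (twistTensor Q m n (star g)) (consL m s n Φ))] with q e2 e3 e4
    refine e4.trans ?_
    rw [Pi.smul_apply, smul_eq_mul]
    congr 1
    exact e2.trans (integral_congr_ae e3)

theorem coeFn_annihilationL {Q : Matrix (Fin (s + 1)) (Fin (s + 1)) ℝ} (hQ : Q.transpose = -Q)
    (g : Lp ℂ 2 (shellMeasure m s)) (Φ : Lp ℂ 2 (shellMeasurePi m s (n + 1))) :
    (∀ᵐ q ∂shellMeasurePi m s n, Integrable
      (fun p => g p * Complex.exp ((Complex.I / 2) *
        (twist Q (shell m p) (totalMomentum m q) : ℝ)) * Φ (Fin.cons p q)) (shellMeasure m s)) ∧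
    annihilationL Q m n g Φ =ᵐ[shellMeasurePi m s n] fun q => ((√(n + 1) : ℝ) : ℂ) *
      ∫ p, g p * Complex.exp ((Complex.I / 2) *
        (twist Q (shell m p) (totalMomentum m q) : ℝ)) * Φ (Fin.cons p q) ∂shellMeasure m s := by
  have h := coeFn_annihilationL_aux Q g Φ
  simpa only [conj_phase hQ] using h

theorem annihilationL_mem (g : Lp ℂ 2 (shellMeasure m s))
    {Φ : Lp ℂ 2 (shellMeasurePi m s (n + 1))} (hΦ : Φ ∈ nParticle m s (n + 1)) :
    annihilationL Q m n g Φ ∈ nParticle m s n := by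
  refine mem_nParticle_of_ae fun ρ => ?_
  have h := (coeFn_annihilationL_aux Q g Φ).2
  -- The permutation `decomposeFin.symm (0, ρ)` fixes the integration variable and acts as `ρ` on
  -- the others.
  have h3 := ae_cons (ae_eq_perm hΦ (Equiv.Perm.decomposeFin.symm (0, ρ)))
  filter_upwards [h, ae_perm ρ h, h3] with q h1 h2 h3
  rw [h1, h2]
  congr 1
  refine integral_congr_ae ?_
  filter_upwards [h3] with p hp
  rw [← hp]
  congr 2
  · simp only [phase, totalMomentum_perm]
  · funext j
    refine Fin.cases ?_ (fun i => ?_) j <;> simp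

/-- The component `ℋₙ₊₁ → ℋₙ` of `a(Q, g)`, as a bilinear map. -/
def annihilationBilin (m : ℝ) (n : ℕ) :
    Lp ℂ 2 (shellMeasure m s) →ₗ[ℂ] nParticle m s (n + 1) →ₗ[ℂ] nParticle m s n :=
  LinearMap.mk₂ ℂ (fun g Φ => ⟨annihilationL Q m n g Φ, annihilationL_mem Q g Φ.2⟩)
    (fun g g' ψ => Subtype.ext (by simp [annihilationL_add]))
    (fun c g ψ => Subtype.ext (by simp [annihilationL_smul]))
    (fun g ψ ψ' => Subtype.ext (by simp))
    (fun c g ψ => Subtype.ext (by simp))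

theorem norm_annihilationBilin_le (g : Lp ℂ 2 (shellMeasure m s)) (Φ : nParticle m s (n + 1)) :
    ‖annihilationBilin Q m n g Φ‖ ≤ √(n + 1) * ‖g‖ * ‖Φ‖ :=
  norm_annihilationL_le Q g (Φ : Lp ℂ 2 (shellMeasurePi m s (n + 1)))

/-- The component `ℋₙ₊₁ → ℋₙ` of `a(Q, g)`. -/
def annihilationBlock (m : ℝ) (n : ℕ) :
    Lp ℂ 2 (shellMeasure m s) →L[ℂ] nParticle m s (n + 1) →L[ℂ] nParticle m s n :=
  LinearMap.mkContinuous₂ (annihilationBilin Q m n) √(n + 1) (norm_annihilationBilin_le Q)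

theorem coe_annihilationBlock (g : Lp ℂ 2 (shellMeasure m s)) (Φ : nParticle m s (n + 1)) :
    (annihilationBlock Q m n g Φ : Lp ℂ 2 (shellMeasurePi m s n)) = annihilationL Q m n g Φ := rfl

theorem norm_creationBlock_le (g : Lp ℂ 2 (shellMeasure m s)) (ψ : nParticle m s n) :
    ‖creationBlock Q m n g ψ‖ ≤ ‖g‖ * √(n + 1) * ‖ψ‖ :=
  (norm_creationBilin_le Q g ψ).trans_eq (by rw [mul_comm ‖g‖])

theorem norm_annihilationBlock_le (g : Lp ℂ 2 (shellMeasure m s)) (Φ : nParticle m s (n + 1)) :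
    ‖annihilationBlock Q m n g Φ‖ ≤ ‖g‖ * √(n + 1) * ‖Φ‖ :=
  (norm_annihilationBilin_le Q g Φ).trans_eq (by rw [mul_comm ‖g‖])

end Blocks

/-! ### Duality of the blocks on symmetric functions. -/

section Blocks

variable {m : ℝ} {s n : ℕ} (Q : Matrix (Fin (s + 1)) (Fin (s + 1)) ℝ)

instance (m : ℝ) (s n : ℕ) : Inner ℂ (nParticle m s n) := InnerProductSpace.toInner

instance (m : ℝ) (s : ℕ) : Inner ℂ (Fock m s) := InnerProductSpace.toInner

theorem inner_creationBlock (g : Lp ℂ 2 (shellMeasure m s)) (ψ : nParticle m s n)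
    (Φ : nParticle m s (n + 1)) :
    ⟪creationBlock Q m n g ψ, Φ⟫_ℂ = ⟪ψ, annihilationBlock Q m n (star g) Φ⟫_ℂ := by
  rw [Submodule.coe_inner, Submodule.coe_inner, coe_creationBlock, coe_annihilationBlock]
  have h := inner_creationL Q g (ψ : Lp ℂ 2 (shellMeasurePi m s n)) Φ.2
  exact h

theorem inner_annihilationBlock (g : Lp ℂ 2 (shellMeasure m s)) (Φ : nParticle m s (n + 1))
    (ψ : nParticle m s n) :
    ⟪annihilationBlock Q m n g Φ, ψ⟫_ℂ = ⟪Φ, creationBlock Q m n (star g) ψ⟫_ℂ := by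
  have h := inner_creationBlock Q (star g) ψ Φ
  rw [star_star] at h
  have h1 : (starRingEnd ℂ) ⟪ψ, annihilationBlock Q m n g Φ⟫_ℂ =
      ⟪annihilationBlock Q m n g Φ, ψ⟫_ℂ := inner_conj_symm _ _
  have h2 : (starRingEnd ℂ) ⟪creationBlock Q m n (star g) ψ, Φ⟫_ℂ =
      ⟪Φ, creationBlock Q m n (star g) ψ⟫_ℂ := inner_conj_symm _ _
  rw [← h1, ← h2, h]

/-- A vector annihilated by all `a(Q, g)` vanishes. -/
theorem eq_zero_of_forall_annihilationBlock {Φ : nParticle m s (n + 1)}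
    (h : ∀ g, annihilationBlock Q m n g Φ = 0) : Φ = 0 := by
  have h0 : consL m s n Φ = 0 := by
    refine eq_zero_of_forall_inner_tensor (measurable_phase Q m n) (norm_phase Q m n) _ fun g ψ => ?_
    have h1 := inner_annihilationL Q (star g) ψ (Φ : Lp ℂ 2 (shellMeasurePi m s (n + 1)))
    rw [← coe_annihilationBlock, h, Submodule.coe_zero, inner_zero_right, star_star] at h1
    refine (mul_eq_zero.1 h1.symm).resolve_left ?_
    have hpos : (0 : ℝ) < √(n + 1) := by positivity
    exact_mod_cast hpos.ne'
  apply Subtype.ext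
  rw [← sepL_zero_consL (Φ : Lp ℂ 2 (shellMeasurePi m s (n + 1))), h0, map_zero,
    Submodule.coe_zero]

end Blocks

/-! ### Band operators on finitely supported vectors and their self-adjoint closures. -/

section BandOperators

variable {H : ℕ → Type*} [∀ n, NormedAddCommGroup (H n)] [∀ n, InnerProductSpace ℂ (H n)]
  {C C' : ∀ n, H n →L[ℂ] H (n + 1)} {A A' : ∀ n, H (n + 1) →L[ℂ] H n}

/-- The raising part of a band operator on a vector with components below `N`. -/
def sumRaise (C : ∀ n, H n →L[ℂ] H (n + 1)) (Ψ : lp H 2) (N : ℕ) : lp H 2 :=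
  ∑ n ∈ Finset.range N, lp.single (E := H) 2 (n + 1) (C n (Ψ n))

/-- The lowering part of a band operator on a vector with components below `N`. -/
def sumLower (A : ∀ n, H (n + 1) →L[ℂ] H n) (Ψ : lp H 2) (N : ℕ) : lp H 2 :=
  ∑ n ∈ Finset.range N, lp.single (E := H) 2 n (A n (Ψ (n + 1)))

theorem sumRaise_zero (Ψ : lp H 2) (N : ℕ) : sumRaise C Ψ N 0 = 0 := by
  rw [sumRaise, lp.coeFn_sum, Finset.sum_apply]
  refine Finset.sum_eq_zero fun n _ => ?_
  rw [lp.single_apply_ne _ _ _ (by omega)]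

theorem sumRaise_succ {Ψ : lp H 2} {N : ℕ} (hΨ : ∀ n, N ≤ n → Ψ n = 0) (k : ℕ) :
    sumRaise C Ψ N (k + 1) = C k (Ψ k) := by
  rw [sumRaise, lp.coeFn_sum, Finset.sum_apply]
  rw [Finset.sum_eq_single k, lp.single_apply_self]
  · intro n _ hn
    rw [lp.single_apply_ne _ _ _ (by omega)]
  · intro hk
    rw [hΨ k (by simpa using hk), map_zero, lp.single_zero]
    rfl

theorem sumLower_apply {Ψ : lp H 2} {N : ℕ} (hΨ : ∀ n, N ≤ n → Ψ n = 0) (k : ℕ) :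
    sumLower A Ψ N k = A k (Ψ (k + 1)) := by
  rw [sumLower, lp.coeFn_sum, Finset.sum_apply]
  rw [Finset.sum_eq_single k, lp.single_apply_self]
  · intro n _ hn
    rw [lp.single_apply_ne _ _ _ (Ne.symm hn)]
  · intro hk
    rw [hΨ (k + 1) (by simp at hk; omega), map_zero, lp.single_zero]
    rfl

theorem IsBandImage.ext {Ψ Φ Φ' : lp H 2} (h : IsBandImage C A Ψ Φ) (h' : IsBandImage C A Ψ Φ') :
    Φ = Φ' := by
  apply lp.ext
  funext n
  cases n with
  | zero => rw [h.1, h'.1]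
  | succ n => rw [h.2, h'.2]

theorem isBandImage_sumRaise_add_sumLower {Ψ : lp H 2} {N : ℕ} (hΨ : ∀ n, N ≤ n → Ψ n = 0) :
    IsBandImage C A Ψ (sumRaise C Ψ N + sumLower A Ψ N) := by
  constructor
  · rw [lp.coeFn_add, Pi.add_apply, sumRaise_zero, sumLower_apply hΨ, zero_add]
  · intro n
    rw [lp.coeFn_add, Pi.add_apply, sumRaise_succ hΨ, sumLower_apply hΨ]

theorem IsBandImage.eq_zero_of_le {Ψ Φ : lp H 2} (h : IsBandImage C A Ψ Φ) {N : ℕ}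
    (hΨ : ∀ n, N ≤ n → Ψ n = 0) : ∀ n, N + 1 ≤ n → Φ n = 0 := by
  intro n hn
  obtain ⟨k, rfl⟩ : ∃ k, n = k + 1 := ⟨n - 1, by omega⟩
  rw [h.2, hΨ k (by omega), hΨ (k + 2) (by omega), map_zero, map_zero, add_zero]

theorem isBandImage_single_zero (x : H 0) :
    IsBandImage C A (lp.single 2 0 x) (lp.single 2 1 (C 0 x)) := by
  constructor
  · rw [lp.single_apply_ne _ _ _ (by omega), lp.single_apply_ne _ _ _ (by omega), map_zero]
  · intro n
    rw [lp.single_apply_ne _ 0 _ (show n + 2 ≠ 0 by omega), map_zero, add_zero]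
    cases n with
    | zero => rw [lp.single_apply_self, lp.single_apply_self]
    | succ n =>
      rw [lp.single_apply_ne _ _ _ (by omega), lp.single_apply_ne _ _ _ (by omega), map_zero]

theorem isBandImage_single_succ (k : ℕ) (x : H (k + 1)) :
    IsBandImage C A (lp.single 2 (k + 1) x)
      (lp.single 2 (k + 2) (C (k + 1) x) + lp.single 2 k (A k x)) := by
  constructor
  · rw [lp.coeFn_add, Pi.add_apply, lp.single_apply_ne _ _ _ (by omega), zero_add]
    cases k with
    | zero => rw [lp.single_apply_self, lp.single_apply_self]
    | succ k =>
      rw [lp.single_apply_ne _ _ _ (by omega), lp.single_apply_ne _ _ _ (by omega), map_zero]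
  · intro n
    rw [lp.coeFn_add, Pi.add_apply]
    congr 1
    · by_cases h : n = k + 1
      · subst h
        rw [lp.single_apply_self, lp.single_apply_self]
      · rw [lp.single_apply_ne _ _ _ (by omega), lp.single_apply_ne _ _ _ h, map_zero]
    · by_cases h : k = n + 1
      · subst h
        rw [lp.single_apply_self, lp.single_apply_self]
      · rw [lp.single_apply_ne _ _ _ (by omega), lp.single_apply_ne _ _ _ (by omega), map_zero]

theorem IsBandImage.inner_eq_sum {Φ Φ' : lp H 2} (h : IsBandImage C A Φ Φ') {Ψ : lp H 2} {N : ℕ}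
    (hΨ : ∀ n, N ≤ n → Ψ n = 0) :
    ⟪Ψ, Φ'⟫_ℂ = ∑ n ∈ Finset.range N, ⟪Ψ (n + 1), C n (Φ n)⟫_ℂ +
      ∑ n ∈ Finset.range N, ⟪Ψ n, A n (Φ (n + 1))⟫_ℂ := by
  have hN1 : ∀ n, N + 1 ≤ n → Ψ n = 0 := fun n hn => hΨ n (by omega)
  have e : ∑ n ∈ Finset.range N, ⟪Ψ n, A n (Φ (n + 1))⟫_ℂ =
      ∑ n ∈ Finset.range (N + 1), ⟪Ψ n, A n (Φ (n + 1))⟫_ℂ := by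
    rw [Finset.sum_range_succ, hΨ N le_rfl, inner_zero_left, add_zero]
  rw [inner_eq_sum_range hN1, e, Finset.sum_range_succ', Finset.sum_range_succ', h.1, ← add_assoc,
    ← Finset.sum_add_distrib]
  simp only [h.2, inner_add_right]

/-- Finite support of `Ψ` alone makes all sums finite; `Φ` may be any vector with a band image. This
allows pairing a finite particle vector with the whole maximal domain of the field. -/
theorem IsBandImage.inner_eq_inner
    (hCA : ∀ n x y, ⟪C n x, y⟫_ℂ = ⟪x, A' n y⟫_ℂ) (hAC : ∀ n x y, ⟪A n x, y⟫_ℂ = ⟪x, C' n y⟫_ℂ)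
    {Ψ Ψ' Φ Φ' : lp H 2} (h : IsBandImage C A Ψ Ψ') (h' : IsBandImage C' A' Φ Φ')
    {N : ℕ} (hΨ : ∀ n, N ≤ n → Ψ n = 0) : ⟪Ψ', Φ⟫_ℂ = ⟪Ψ, Φ'⟫_ℂ := by
  have e := h.ext (isBandImage_sumRaise_add_sumLower hΨ)
  rw [h'.inner_eq_sum hΨ, e, inner_add_left, sumRaise, sumLower, sum_inner, sum_inner, add_comm]
  simp only [lp.inner_single_left, hCA, hAC]

theorem dense_of_single_mem (D : Submodule ℂ (lp H 2))
    (hD : ∀ n (x : H n), lp.single 2 n x ∈ D) : Dense (D : Set (lp H 2)) := by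
  intro Ψ
  exact mem_closure_of_tendsto (lp.hasSum_single (by norm_num) Ψ).tendsto_sum_nat
    (Eventually.of_forall fun N => D.sum_mem fun n _ => hD n _)

variable [∀ n, CompleteSpace (H n)]

/-- A symmetric band operator on finitely supported vectors, with components growing at most like
`√n`, is essentially self-adjoint. -/
theorem isSelfAdjoint_closure_of_isBandImage {c : ℝ} (hc : 0 ≤ c)
    (hC : ∀ n x, ‖C n x‖ ≤ c * √(n + 1) * ‖x‖) (hA : ∀ n x, ‖A n x‖ ≤ c * √(n + 1) * ‖x‖)
    (hCA : ∀ n x y, ⟪C n x, y⟫_ℂ = ⟪x, A n y⟫_ℂ) {T : lp H 2 →ₗ.[ℂ] lp H 2}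
    (hT : ∀ Ψ : T.domain, IsBandImage C A Ψ (T Ψ))
    (hfin : ∀ Ψ : T.domain, ∃ N : ℕ, ∀ n, N ≤ n → (Ψ : lp H 2) n = 0)
    (hsingle : ∀ n (x : H n), lp.single 2 n x ∈ T.domain) :
    T.IsClosable ∧ IsSelfAdjoint T.closure := by
  have hAC : ∀ n x y, ⟪A n x, y⟫_ℂ = ⟪x, C n y⟫_ℂ := fun n x y => by
    rw [← inner_conj_symm, ← hCA, inner_conj_symm]
  have hd : Dense (T.domain : Set (lp H 2)) := dense_of_single_mem _ hsingle
  have hgraph : ∀ Ψ Φ, Ψ ∈ T.domain → IsBandImage C A Ψ Φ → (Ψ, Φ) ∈ T.graph := by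
    intro Ψ Φ hΨ hΦ
    rw [hΦ.ext (hT ⟨Ψ, hΨ⟩)]
    exact T.mem_graph ⟨Ψ, hΨ⟩
  refine isClosable_and_isSelfAdjoint_closure hd ?_ ?_
  · intro x y
    obtain ⟨N, hN⟩ := hfin x
    exact (hT x).inner_eq_inner hCA hAC (hT y) hN
  · rintro ⟨y, y'⟩ hy
    obtain ⟨w, rfl, rfl⟩ := (LinearPMap.mem_graph_iff _).1 hy
    have hw : ∀ (x : T.domain) (x' : lp H 2), IsBandImage C A x x' →
        ⟪T.adjoint w, (x : lp H 2)⟫_ℂ = ⟪(w : lp H 2), x'⟫_ℂ := by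
      intro x x' hx
      rw [hx.ext (hT x)]
      exact LinearPMap.adjoint_isFormalAdjoint hd w x
    -- Testing against vectors with a single non-zero component reads off `T†w` degree by degree,
    -- showing that it is the band image of `w`.
    refine IsBandImage.mem_topologicalClosure hc hC hA (Ψ := w) (Φ := T.adjoint w) ⟨?_, ?_⟩
      (fun x => hgraph _ _ (hsingle 0 x) (isBandImage_single_zero x))
      (fun n x => hgraph _ _ (hsingle (n + 1) x) (isBandImage_single_succ n x))
    · refine ext_inner_right ℂ fun x => ?_
      have h := hw ⟨_, hsingle 0 x⟩ _ (isBandImage_single_zero x)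
      simp only [lp.inner_single_right] at h
      rw [h, hAC]
    · intro n
      refine ext_inner_right ℂ fun x => ?_
      have h := hw ⟨_, hsingle (n + 1) x⟩ _ (isBandImage_single_succ n x)
      simp only [inner_add_right, lp.inner_single_right] at h
      rw [h, inner_add_left, hAC, hCA, add_comm]

end BandOperators

/-! ### Identification of the maximal operators with their bounded blocks. -/

section Graphs

variable {m : ℝ} {s : ℕ} {Q : Matrix (Fin (s + 1)) (Fin (s + 1)) ℝ}

theorem wave_ae_eq_zero_iff {Ψ : Fock m s} {n : ℕ} :
    wave Ψ n =ᵐ[shellMeasurePi m s n] 0 ↔ Ψ n = 0 := by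
  rw [← Submodule.coe_eq_zero]
  exact (Lp.eq_zero_iff_ae_eq_zero).symm

theorem wave_ae_eq_iff {Ψ : Fock m s} {n : ℕ} {Φ : nParticle m s n} :
    wave Ψ n =ᵐ[shellMeasurePi m s n] (Φ : Lp ℂ 2 (shellMeasurePi m s n)) ↔ Ψ n = Φ := by
  rw [Subtype.ext_iff]
  exact ⟨fun h => Lp.ext h, fun h => by rw [← h]; rfl⟩

theorem creationWave_ae_eq {g : Momentum s → ℂ} {G : Lp ℂ 2 (shellMeasure m s)}
    (hG : G =ᵐ[shellMeasure m s] g) (Ψ : Fock m s) (n : ℕ) :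
    (creationBlock Q m n G (Ψ n) : Lp ℂ 2 (shellMeasurePi m s (n + 1)))
      =ᵐ[shellMeasurePi m s (n + 1)] creationWave Q g Ψ (n + 1) := by
  have h : ∀ᵐ q ∂shellMeasurePi m s (n + 1), ∀ k : Fin (n + 1), G (q k) = g (q k) :=
    ae_all_iff.2 fun k => ae_sep k (Measure.quasiMeasurePreserving_fst.ae hG)
  filter_upwards [coeFn_creationL Q G (Ψ n : Lp ℂ 2 (shellMeasurePi m s n)), h] with q h1 h2
  rw [coe_creationBlock, h1, creationWave]
  simp only [h2]
  rfl

/-- For `g` in `L²` the pointwise formula is a bounded block in each degree, so the only domain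
restriction is that the components assemble to a Fock space vector. -/
theorem mem_creationGraph_iff {g : Momentum s → ℂ} {G : Lp ℂ 2 (shellMeasure m s)}
    (hG : G =ᵐ[shellMeasure m s] g) {Ψ Φ : Fock m s} :
    (Ψ, Φ) ∈ creationGraph m Q g ↔
      Φ 0 = 0 ∧ ∀ n, Φ (n + 1) = creationBlock Q m n G (Ψ n) := by
  have h0 : creationWave (m := m) Q g Ψ 0 = 0 := rfl
  have hmem : (Ψ, Φ) ∈ creationGraph m Q g ↔
    ∀ n, wave Φ n =ᵐ[shellMeasurePi m s n] creationWave Q g Ψ n := Iff.rfl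
  rw [hmem]
  constructor
  · intro h
    refine ⟨?_, fun n => ?_⟩
    · have h1 := h 0
      rw [h0] at h1
      exact wave_ae_eq_zero_iff.1 h1
    · exact wave_ae_eq_iff.1 ((h (n + 1)).trans (creationWave_ae_eq hG Ψ n).symm)
  · rintro ⟨h1, h2⟩ n
    cases n with
    | zero =>
      rw [h0]
      exact wave_ae_eq_zero_iff.2 h1
    | succ n => exact (wave_ae_eq_iff.2 (h2 n)).trans (creationWave_ae_eq hG Ψ n)

theorem annihilationWave_ae_eq (hQ : Q.transpose = -Q) {g : Momentum s → ℂ}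
    {G : Lp ℂ 2 (shellMeasure m s)} (hG : G =ᵐ[shellMeasure m s] g) (Ψ : Fock m s) (n : ℕ) :
    (∀ᵐ q ∂shellMeasurePi m s n,
      Integrable (annihilationIntegrand Q g Ψ n q) (shellMeasure m s)) ∧
    (annihilationBlock Q m n G (Ψ (n + 1)) : Lp ℂ 2 (shellMeasurePi m s n))
      =ᵐ[shellMeasurePi m s n] annihilationWave Q g Ψ n := by
  obtain ⟨h1, h2⟩ := coeFn_annihilationL hQ G
    (Ψ (n + 1) : Lp ℂ 2 (shellMeasurePi m s (n + 1)))
  have h3 : ∀ q : Fin n → Momentum s, (fun p => G p * Complex.exp ((Complex.I / 2) *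
      (twist Q (shell m p) (totalMomentum m q) : ℝ)) *
        (Ψ (n + 1) : Lp ℂ 2 (shellMeasurePi m s (n + 1))) (Fin.cons p q))
      =ᵐ[shellMeasure m s] annihilationIntegrand Q g Ψ n q := by
    intro q
    filter_upwards [hG] with p hp
    rw [hp]
    rfl
  constructor
  · filter_upwards [h1] with q e1
    exact e1.congr (h3 q)
  · filter_upwards [h2] with q e2
    rw [coe_annihilationBlock, e2, annihilationWave, integral_congr_ae (h3 q)]

/-- For `g` in `L²` the integral converges for almost every `q`, so the integrability clause drops
out. -/
theorem mem_annihilationGraph_iff (hQ : Q.transpose = -Q) {g : Momentum s → ℂ}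
    {G : Lp ℂ 2 (shellMeasure m s)} (hG : G =ᵐ[shellMeasure m s] g) {Ψ Φ : Fock m s} :
    (Ψ, Φ) ∈ annihilationGraph m Q g ↔ ∀ n, Φ n = annihilationBlock Q m n G (Ψ (n + 1)) := by
  have hmem : (Ψ, Φ) ∈ annihilationGraph m Q g ↔ ∀ n, (∀ᵐ q ∂shellMeasurePi m s n,
      Integrable (annihilationIntegrand Q g Ψ n q) (shellMeasure m s)) ∧
      wave Φ n =ᵐ[shellMeasurePi m s n] annihilationWave Q g Ψ n := Iff.rfl
  rw [hmem]
  refine forall_congr' fun n => ?_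
  obtain ⟨h1, h2⟩ := annihilationWave_ae_eq hQ hG Ψ n
  exact ⟨fun h => wave_ae_eq_iff.1 (h.2.trans h2.symm),
    fun h => ⟨h1, (wave_ae_eq_iff.2 h).trans h2⟩⟩

/-- The sum `a*(Q, g) + a(Q, g')` of the twisted creation and annihilation operators acts as a
band operator. -/
theorem isBandImage_creation_add_annihilation (hQ : Q.transpose = -Q) {g g' : Momentum s → ℂ}
    {G G' : Lp ℂ 2 (shellMeasure m s)} (hG : G =ᵐ[shellMeasure m s] g)
    (hG' : G' =ᵐ[shellMeasure m s] g') (Ψ : (creation m Q g + annihilation m Q g').domain) :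
    IsBandImage (fun n => creationBlock Q m n G) (fun n => annihilationBlock Q m n G')
      (Ψ : Fock m s) ((creation m Q g + annihilation m Q g') Ψ) := by
  have key : ∀ c a : Fock m s, ((Ψ : Fock m s), c) ∈ creationGraph m Q g →
      ((Ψ : Fock m s), a) ∈ annihilationGraph m Q g' →
      IsBandImage (fun n => creationBlock Q m n G) (fun n => annihilationBlock Q m n G')
        (Ψ : Fock m s) (c + a) := by
    intro c a h1 h2
    rw [mem_creationGraph_iff hG] at h1
    rw [mem_annihilationGraph_iff hQ hG'] at h2
    have h0 := h2 0
    refine ⟨?_, fun n => ?_⟩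
    · rw [lp.coeFn_add, Pi.add_apply, h1.1, zero_add]
      exact h0
    · have h3 := h1.2 n
      have h4 := h2 (n + 1)
      rw [lp.coeFn_add, Pi.add_apply]
      exact congrArg₂ (· + ·) h3 h4
  refine key (creation m Q g ⟨Ψ, Ψ.2.1⟩) (annihilation m Q g' ⟨Ψ, Ψ.2.2⟩) ?_ ?_
  · rw [← graph_creation]
    exact LinearPMap.mem_graph (creation m Q g) ⟨Ψ, Ψ.2.1⟩
  · rw [← graph_annihilation]
    exact LinearPMap.mem_graph (annihilation m Q g') ⟨Ψ, Ψ.2.2⟩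

theorem mem_domain_creation_add_annihilation (hQ : Q.transpose = -Q) {g g' : Momentum s → ℂ}
    {G G' : Lp ℂ 2 (shellMeasure m s)} (hG : G =ᵐ[shellMeasure m s] g)
    (hG' : G' =ᵐ[shellMeasure m s] g') {Ψ : Fock m s} {N : ℕ} (hΨ : ∀ n, N ≤ n → Ψ n = 0) :
    Ψ ∈ (creation m Q g + annihilation m Q g').domain := by
  refine ⟨?_, ?_⟩
  · refine LinearPMap.mem_domain_of_mem_graph
      (y := sumRaise (fun n => creationBlock Q m n G) Ψ N) ?_
    rw [graph_creation, mem_creationGraph_iff hG]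
    exact ⟨sumRaise_zero _ _, sumRaise_succ hΨ⟩
  · refine LinearPMap.mem_domain_of_mem_graph
      (y := sumLower (fun n => annihilationBlock Q m n G') Ψ N) ?_
    rw [graph_annihilation, mem_annihilationGraph_iff hQ hG']
    exact sumLower_apply hΨ

end Graphs

/-! ### Fourier transforms of test functions on the mass shell. -/

section TestFunctions

variable {m : ℝ} {s : ℕ}

/-- `ω_p ≥ m`. This transfers temperate growth from Lebesgue measure, so Schwartz functions embed
continuously in `L²` of the shell. -/
theorem shellMeasure_le (hm : 0 < m) (s : ℕ) :
    shellMeasure m s ≤ ENNReal.ofReal m⁻¹ • (volume : Measure (Momentum s)) := by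
  rw [← withDensity_const]
  refine withDensity_mono (Eventually.of_forall fun p => ENNReal.ofReal_le_ofReal ?_)
  refine inv_anti₀ hm (Real.le_sqrt_of_sq_le ?_)
  nlinarith [sq_nonneg ‖p‖]

theorem hasTemperateGrowth_shellMeasure (hm : 0 < m) (s : ℕ) :
    (shellMeasure m s).HasTemperateGrowth := by
  obtain ⟨n, hn⟩ := (inferInstance :
    (volume : Measure (Momentum s)).HasTemperateGrowth).exists_integrable
  exact ⟨n, (hn.smul_measure ENNReal.ofReal_ne_top).mono_measure (shellMeasure_le hm s)⟩

/-- For positive mass, `ω_p = m (1 + ‖p/m‖²)^{1/2}` is a rescaled smooth power. -/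
theorem hasTemperateGrowth_energy (hm : 0 < m) :
    (energy m : Momentum s → ℝ).HasTemperateGrowth := by
  have h : (energy m : Momentum s → ℝ) =
      fun p => m * (1 + ‖(m⁻¹ • ContinuousLinearMap.id ℝ (Momentum s)) p‖ ^ 2) ^ (1 / 2 : ℝ) := by
    funext p
    rw [energy, ← Real.sqrt_eq_rpow]
    have e : ‖p‖ ^ 2 + m ^ 2 =
        m ^ 2 * (1 + ‖(m⁻¹ • ContinuousLinearMap.id ℝ (Momentum s)) p‖ ^ 2) := by
      simp only [smul_apply, ContinuousLinearMap.id_apply, norm_smul, norm_inv,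
        Real.norm_eq_abs, mul_pow, inv_pow, sq_abs]
      field_simp
      ring
    rw [e, Real.sqrt_mul (sq_nonneg m), Real.sqrt_sq hm.le]
  rw [h]
  exact (Function.HasTemperateGrowth.const m).mul
    ((Function.hasTemperateGrowth_one_add_norm_sq_rpow (Momentum s) (1 / 2)).comp
      (m⁻¹ • ContinuousLinearMap.id ℝ (Momentum s)).hasTemperateGrowth)

/-- The covariant components of the point `(ω_p, p)` of the mass shell. -/
def coshell (m : ℝ) {s : ℕ} (p : Momentum s) : Spacetime s := WithLp.toLp 2 (lower (shell m p))

theorem coshell_zero (p : Momentum s) : coshell m p 0 = energy m p := rfl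

theorem coshell_succ (p : Momentum s) (k : Fin s) : coshell m p k.succ = -p k := by
  simp [coshell, lower, shell]

theorem inner_coshell (p : Momentum s) (x : Spacetime s) :
    ⟪x, coshell m p⟫_ℝ = mdot (shell m p) x := by
  rw [PiLp.inner_apply, Fin.sum_univ_succ, mdot, sub_eq_add_neg, ← Finset.sum_neg_distrib]
  simp only [coshell_zero, coshell_succ]
  simp [shell]

/-- The inclusion of space into Minkowski space. -/
def spatial (s : ℕ) : Momentum s →L[ℝ] Spacetime s :=
  LinearMap.toContinuousLinearMap
    { toFun := fun p => WithLp.toLp 2 (Fin.cons 0 fun k => p k)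
      map_add' := fun p q => by
        ext i
        refine Fin.cases ?_ (fun k => ?_) i <;> simp
      map_smul' := fun c p => by
        ext i
        refine Fin.cases ?_ (fun k => ?_) i <;> simp }

theorem coshell_eq (p : Momentum s) :
    coshell m p = energy m p • EuclideanSpace.single (0 : Fin (s + 1)) (1 : ℝ) - spatial s p := by
  ext i
  refine Fin.cases ?_ (fun k => ?_) i
  · simp [coshell_zero, spatial]
  · simp [coshell_succ, spatial]

theorem hasTemperateGrowth_coshell (hm : 0 < m) :
    (coshell m : Momentum s → Spacetime s).HasTemperateGrowth := by
  have h1 := ((hasTemperateGrowth_energy hm).smul (Function.HasTemperateGrowth.const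
    (EuclideanSpace.single (0 : Fin (s + 1)) (1 : ℝ)))).sub (spatial s).hasTemperateGrowth
  refine (congrArg _ (funext fun p => ?_)).mp h1
  rw [coshell_eq]
  rfl

/-- This lower bound ensures that composition with the shell map preserves Schwartz decay. -/
theorem norm_le_norm_coshell (p : Momentum s) : ‖p‖ ≤ ‖coshell m p‖ := by
  refine (sq_le_sq₀ (norm_nonneg _) (norm_nonneg _)).1 ?_
  rw [EuclideanSpace.norm_sq_eq, EuclideanSpace.norm_sq_eq, Fin.sum_univ_succ]
  simp only [coshell_succ, norm_neg]
  exact le_add_of_nonneg_left (sq_nonneg _)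

theorem hasTemperateGrowth_smul_coshell (hm : 0 < m) (c : ℝ) :
    (fun p : Momentum s => c • coshell m p).HasTemperateGrowth :=
  (Function.HasTemperateGrowth.const c).smul (hasTemperateGrowth_coshell hm)

/-- The restriction of the Fourier transform of `f` to a multiple of the mass shell. -/
def shellFourier (hm : 0 < m) (s : ℕ) {c : ℝ} (hc : c ≠ 0) :
    𝓢(Spacetime s, ℂ) →L[ℂ] 𝓢(Momentum s, ℂ) :=
  (SchwartzMap.compCLM ℂ (hasTemperateGrowth_smul_coshell hm c) ⟨1, |c|⁻¹, fun p => by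
    have hc' : 0 < |c| := abs_pos.2 hc
    rw [pow_one, norm_smul, Real.norm_eq_abs, inv_mul_eq_div, le_div_iff₀ hc']
    nlinarith [norm_le_norm_coshell (m := m) p]⟩) ∘L SchwartzMap.fourierTransformCLM ℂ

theorem shellFourier_apply (hm : 0 < m) {c : ℝ} (hc : c ≠ 0) (f : 𝓢(Spacetime s, ℂ))
    (p : Momentum s) : shellFourier hm s hc f p =
      ∫ x, f x * Complex.exp (((-2 * Real.pi * c * mdot (shell m p) x : ℝ) : ℂ) * Complex.I) := by
  change FourierTransform.fourier (f : Spacetime s → ℂ) (c • coshell m p) = _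
  rw [Real.fourier_eq']
  refine integral_congr_ae (Eventually.of_forall fun x => ?_)
  simp only [inner_smul_right, inner_coshell, smul_eq_mul]
  rw [mul_comm]
  congr 4
  ring

theorem neg_inv_two_pi_ne_zero : (-(2 * Real.pi)⁻¹ : ℝ) ≠ 0 := by
  have := Real.pi_pos
  exact neg_ne_zero.2 (by positivity)

theorem inv_two_pi_ne_zero : ((2 * Real.pi)⁻¹ : ℝ) ≠ 0 := by
  have := Real.pi_pos
  positivity

/-- The factor `-(2π)⁻¹` cancels the `2π` in the Fourier exponent and reverses its sign. -/
theorem shellFourier_eq_testPlus (hm : 0 < m) (f : 𝓢(Spacetime s, ℂ)) (p : Momentum s) :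
    shellFourier hm s neg_inv_two_pi_ne_zero f p = testPlus m f p := by
  rw [shellFourier_apply, testPlus]
  refine integral_congr_ae (Eventually.of_forall fun x => ?_)
  have := Real.pi_pos
  simp only
  rw [show -2 * Real.pi * -(2 * Real.pi)⁻¹ * mdot (shell m p) x = mdot (shell m p) x by field_simp,
    mul_comm Complex.I]

theorem shellFourier_eq_testMinus (hm : 0 < m) (f : 𝓢(Spacetime s, ℂ)) (p : Momentum s) :
    shellFourier hm s inv_two_pi_ne_zero f p = testMinus m f p := by
  rw [shellFourier_apply, testMinus]
  refine integral_congr_ae (Eventually.of_forall fun x => ?_)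
  have := Real.pi_pos
  simp only
  rw [show -2 * Real.pi * (2 * Real.pi)⁻¹ * mdot (shell m p) x = -mdot (shell m p) x by field_simp]
  push_cast
  rw [neg_mul, neg_mul, mul_comm Complex.I]

/-- `f ↦ f⁺` as a continuous map from test functions into `L²` of the mass shell. -/
def testPlusL (hm : 0 < m) (s : ℕ) : 𝓢(Spacetime s, ℂ) →L[ℂ] Lp ℂ 2 (shellMeasure m s) :=
  haveI := hasTemperateGrowth_shellMeasure hm s
  SchwartzMap.toLpCLM ℂ ℂ 2 (shellMeasure m s) ∘L shellFourier hm s neg_inv_two_pi_ne_zero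

/-- `f ↦ f⁻` as a continuous map from test functions into `L²` of the mass shell. -/
def testMinusL (hm : 0 < m) (s : ℕ) : 𝓢(Spacetime s, ℂ) →L[ℂ] Lp ℂ 2 (shellMeasure m s) :=
  haveI := hasTemperateGrowth_shellMeasure hm s
  SchwartzMap.toLpCLM ℂ ℂ 2 (shellMeasure m s) ∘L shellFourier hm s inv_two_pi_ne_zero

theorem coeFn_testPlusL (hm : 0 < m) (f : 𝓢(Spacetime s, ℂ)) :
    testPlusL hm s f =ᵐ[shellMeasure m s] testPlus m f := by
  have := hasTemperateGrowth_shellMeasure hm s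
  refine (SchwartzMap.coeFn_toLp (shellFourier hm s neg_inv_two_pi_ne_zero f) 2
    (shellMeasure m s)).trans (Eventually.of_forall (shellFourier_eq_testPlus hm f))

theorem coeFn_testMinusL (hm : 0 < m) (f : 𝓢(Spacetime s, ℂ)) :
    testMinusL hm s f =ᵐ[shellMeasure m s] testMinus m f := by
  have := hasTemperateGrowth_shellMeasure hm s
  refine (SchwartzMap.coeFn_toLp (shellFourier hm s inv_two_pi_ne_zero f) 2
    (shellMeasure m s)).trans (Eventually.of_forall (shellFourier_eq_testMinus hm f))

theorem continuous_testPlus (hm : 0 < m) (f : 𝓢(Spacetime s, ℂ)) : Continuous (testPlus m f) := by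
  rw [← funext (shellFourier_eq_testPlus hm f)]
  exact SchwartzMap.continuous _

theorem testPlus_conjTest (f : 𝓢(Spacetime s, ℂ)) (p : Momentum s) :
    testPlus m (conjTest f) p = (starRingEnd ℂ) (testMinus m f p) := by
  rw [testPlus, testMinus, ← integral_conj]
  refine integral_congr_ae (Eventually.of_forall fun x => ?_)
  simp only [conjTest_apply, map_mul, ← Complex.exp_conj, map_neg, Complex.conj_I,
    Complex.conj_ofReal, neg_neg]

theorem testMinus_conjTest (f : 𝓢(Spacetime s, ℂ)) (p : Momentum s) :
    testMinus m (conjTest f) p = (starRingEnd ℂ) (testPlus m f p) := by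
  rw [testPlus, testMinus, ← integral_conj]
  refine integral_congr_ae (Eventually.of_forall fun x => ?_)
  simp only [conjTest_apply, map_mul, ← Complex.exp_conj, Complex.conj_I, Complex.conj_ofReal]

theorem star_testMinusL (hm : 0 < m) (f : 𝓢(Spacetime s, ℂ)) :
    star (testMinusL hm s f) = testPlusL hm s (conjTest f) := by
  apply Lp.ext
  filter_upwards [Lp.coeFn_star (testMinusL hm s f), coeFn_testMinusL hm f,
    coeFn_testPlusL hm (conjTest f)] with p h1 h2 h3
  rw [h1, h3, Pi.star_apply, h2, testPlus_conjTest]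
  rfl

theorem star_testPlusL (hm : 0 < m) (f : 𝓢(Spacetime s, ℂ)) :
    star (testPlusL hm s f) = testMinusL hm s (conjTest f) := by
  apply Lp.ext
  filter_upwards [Lp.coeFn_star (testPlusL hm s f), coeFn_testPlusL hm f,
    coeFn_testMinusL hm (conjTest f)] with p h1 h2 h3
  rw [h1, h3, Pi.star_apply, h2, testMinus_conjTest]
  rfl

theorem mdot_add (p x y : Spacetime s) : mdot p (x + y) = mdot p x + mdot p y := by
  simp only [mdot, PiLp.add_apply, mul_add, Finset.sum_add_distrib]
  ring

/-- Translation becomes multiplication by a character, which turns orthogonality to all translates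
into a statement on Fourier transforms. -/
theorem testPlus_translate (f : 𝓢(Spacetime s, ℂ)) (a : Spacetime s) (p : Momentum s) :
    testPlus m (SchwartzMap.compSubConstCLM ℂ a f) p =
      testPlus m f p * Complex.exp (Complex.I * (mdot (shell m p) a : ℝ)) := by
  rw [testPlus, testPlus, ← integral_mul_const,
    ← integral_add_right_eq_self _ a]
  refine integral_congr_ae (Eventually.of_forall fun x => ?_)
  simp only [SchwartzMap.compSubConstCLM_apply, add_sub_cancel_right, mdot_add]
  push_cast
  rw [mul_add, Complex.exp_add]
  ring

end TestFunctions

/-! ### Analytic continuation of Laplace and Fourier integrals. -/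

section Laplace

variable {α : Type*} [MeasurableSpace α] {μ : Measure α}

/-- Half of the margin `δ` absorbs the factor `|r|`, the other half the displacement `y - x`. The
bound dominates the derivative of the integrand on a disc of radius `δ / 2`. -/
theorem abs_mul_exp_le {δ : ℝ} (hδ : 0 < δ) {r x y : ℝ} (hy : |y - x| ≤ δ / 2) :
    |r| * Real.exp (y * r) ≤
      2 / δ * (Real.exp ((x + δ) * r) + Real.exp ((x - δ) * r)) := by
  have h1 : |r| ≤ 2 / δ * Real.exp (δ / 2 * |r|) := by
    have h := Real.add_one_le_exp (δ / 2 * |r|)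
    rw [div_mul_eq_mul_div, le_div_iff₀ hδ]
    nlinarith
  have h2 : y * r ≤ x * r + δ / 2 * |r| := by
    have h := (le_abs_self ((y - x) * r)).trans_eq (abs_mul _ _)
    nlinarith [abs_nonneg r]
  have h3 : Real.exp (x * r + δ * |r|) ≤ Real.exp ((x + δ) * r) + Real.exp ((x - δ) * r) := by
    rcases abs_cases r with ⟨e, -⟩ | ⟨e, -⟩ <;> rw [e]
    · rw [show x * r + δ * r = (x + δ) * r by ring]
      exact le_add_of_nonneg_right (Real.exp_pos _).le
    · rw [show x * r + δ * -r = (x - δ) * r by ring]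
      exact le_add_of_nonneg_left (Real.exp_pos _).le
  calc |r| * Real.exp (y * r)
      ≤ 2 / δ * Real.exp (δ / 2 * |r|) * Real.exp (x * r + δ / 2 * |r|) :=
        mul_le_mul h1 (Real.exp_le_exp.2 h2) (Real.exp_pos _).le (by positivity)
    _ = 2 / δ * Real.exp (x * r + δ * |r|) := by
        rw [mul_assoc, ← Real.exp_add]
        ring_nf
    _ ≤ _ := by gcongr

theorem norm_cexp_mul_ofReal (z : ℂ) (r : ℝ) : ‖Complex.exp (z * r)‖ = Real.exp (z.re * r) := by
  rw [Complex.norm_exp, Complex.re_mul_ofReal]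

/-- A two-sided Laplace transform is holomorphic in the interior of its domain of convergence. -/
theorem differentiableAt_laplace {h : α → ℂ} {a : α → ℝ} (hh : AEStronglyMeasurable h μ)
    (ha : AEMeasurable a μ) {z : ℂ} {δ : ℝ} (hδ : 0 < δ)
    (h1 : Integrable (fun p => ‖h p‖ * Real.exp ((z.re + δ) * a p)) μ)
    (h2 : Integrable (fun p => ‖h p‖ * Real.exp ((z.re - δ) * a p)) μ) :
    DifferentiableAt ℂ (fun z : ℂ => ∫ p, h p * Complex.exp (z * a p) ∂μ) z := by
  have hmeas (w : ℂ) : AEStronglyMeasurable (fun p => h p * Complex.exp (w * a p)) μ := by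
    refine hh.mul (AEMeasurable.aestronglyMeasurable ?_)
    exact Complex.measurable_exp.comp_aemeasurable
      ((Complex.measurable_ofReal.comp_aemeasurable ha).const_mul w)
  have hb := (h1.add h2).const_mul (2 / δ)
  have hint : Integrable (fun p => h p * Complex.exp (z * a p)) μ := by
    refine (h1.add h2).mono' (hmeas z) (Eventually.of_forall fun p => ?_)
    rw [norm_mul, norm_cexp_mul_ofReal, Pi.add_apply, ← mul_add]
    refine mul_le_mul_of_nonneg_left ?_ (norm_nonneg _)
    rcases le_total 0 (a p) with ha | ha
    · refine (Real.exp_le_exp.2 ?_).trans (le_add_of_nonneg_right (Real.exp_pos _).le)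
      nlinarith
    · refine (Real.exp_le_exp.2 ?_).trans (le_add_of_nonneg_left (Real.exp_pos _).le)
      nlinarith
  refine (hasDerivAt_integral_of_dominated_loc_of_deriv_le
    (F := fun (w : ℂ) p => h p * Complex.exp (w * a p))
    (F' := fun w p => h p * (Complex.exp (w * a p) * a p))
    (Metric.closedBall_mem_nhds z (half_pos hδ)) (Eventually.of_forall hmeas) hint
    ?_ (Eventually.of_forall fun p w hw => ?_) hb
    (Eventually.of_forall fun p w _ => ?_)).2.differentiableAt
  · have hm : AEStronglyMeasurable (fun p => (a p : ℂ)) μ :=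
      (Complex.measurable_ofReal.comp_aemeasurable ha).aestronglyMeasurable
    have := (hmeas z).mul hm
    refine this.congr (Eventually.of_forall fun p => ?_)
    simp [mul_assoc]
  · rw [norm_mul, norm_mul, norm_cexp_mul_ofReal, Complex.norm_real, Real.norm_eq_abs,
      mul_comm (Real.exp _), Pi.add_apply, ← mul_add, mul_left_comm (2 / δ)]
    refine mul_le_mul_of_nonneg_left (abs_mul_exp_le hδ ?_) (norm_nonneg _)
    rw [Metric.mem_closedBall, Complex.dist_eq] at hw
    exact (Complex.abs_re_le_norm (w - z)).trans hw
  · have := ((hasDerivAt_id w).mul_const (a p : ℂ)).cexp.const_mul (h p)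
    simpa using this

theorem complex_sin_re (u : ℂ) : (Complex.sin u).re = Real.sin u.re * Real.cosh u.im := by
  rw [Complex.sin_eq u, ← Complex.ofReal_sin, ← Complex.ofReal_cos, ← Complex.ofReal_sinh,
    ← Complex.ofReal_cosh]
  simp [-Complex.ofReal_sin, -Complex.ofReal_cos, -Complex.ofReal_sinh, -Complex.ofReal_cosh]

theorem complex_sin_im (u : ℂ) : (Complex.sin u).im = Real.cos u.re * Real.sinh u.im := by
  rw [Complex.sin_eq u, ← Complex.ofReal_sin, ← Complex.ofReal_cos, ← Complex.ofReal_sinh,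
    ← Complex.ofReal_cosh]
  simp [-Complex.ofReal_sin, -Complex.ofReal_cos, -Complex.ofReal_sinh, -Complex.ofReal_cosh]

theorem complex_cos_re (u : ℂ) : (Complex.cos u).re = Real.cos u.re * Real.cosh u.im := by
  rw [Complex.cos_eq u, ← Complex.ofReal_sin, ← Complex.ofReal_cos, ← Complex.ofReal_sinh,
    ← Complex.ofReal_cosh]
  simp [-Complex.ofReal_sin, -Complex.ofReal_cos, -Complex.ofReal_sinh, -Complex.ofReal_cosh]

theorem complex_cos_im (u : ℂ) : (Complex.cos u).im = -(Real.sin u.re * Real.sinh u.im) := by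
  rw [Complex.cos_eq u, ← Complex.ofReal_sin, ← Complex.ofReal_cos, ← Complex.ofReal_sinh,
    ← Complex.ofReal_cosh]
  simp [-Complex.ofReal_sin, -Complex.ofReal_cos, -Complex.ofReal_sinh, -Complex.ofReal_cosh]

theorem cos_ne_zero_of_re {u : ℂ} (h0 : 0 ≤ u.re) (h1 : u.re ≤ 1) : Complex.cos u ≠ 0 := by
  have hpi := Real.pi_gt_three
  have hc : 0 < Real.cos u.re := Real.cos_pos_of_mem_Ioo ⟨by linarith, by linarith⟩
  intro h
  have e := complex_cos_re u
  rw [h, Complex.zero_re] at e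
  exact (mul_pos hc (Real.cosh_pos _)).ne e

/-- The real part of `sin u * conj (cos u)` is `sin (re u) * cos (re u)`, since `cosh² - sinh² = 1`.
Hence `tan` maps the strip into the right half-plane. -/
theorem re_tan_pos {u : ℂ} (h0 : 0 < u.re) (h1 : u.re ≤ 1) : 0 < (Complex.tan u).re := by
  have hpi := Real.pi_gt_three
  have hs : 0 < Real.sin u.re := Real.sin_pos_of_pos_of_lt_pi h0 (by linarith)
  have hc : 0 < Real.cos u.re := Real.cos_pos_of_mem_Ioo ⟨by linarith, by linarith⟩
  have hcosh := Real.cosh_sq u.im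
  rw [Complex.tan_eq_sin_div_cos, Complex.div_re, ← add_div]
  refine div_pos ?_ (Complex.normSq_pos.2 (cos_ne_zero_of_re h0.le h1))
  rw [complex_sin_re, complex_sin_im, complex_cos_re, complex_cos_im]
  have e : Real.sin u.re * Real.cosh u.im * (Real.cos u.re * Real.cosh u.im) +
      Real.cos u.re * Real.sinh u.im * -(Real.sin u.re * Real.sinh u.im) =
      Real.sin u.re * Real.cos u.re * (Real.cosh u.im ^ 2 - Real.sinh u.im ^ 2) := by ring
  rw [e, hcosh, add_sub_cancel_left, mul_one]
  exact mul_pos hs hc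

theorem re_tan_nonneg {u : ℂ} (h0 : 0 ≤ u.re) (h1 : u.re ≤ 1) : 0 ≤ (Complex.tan u).re := by
  rcases h0.eq_or_lt with h | h
  · have hu : u = (u.im : ℂ) * Complex.I := by
      apply Complex.ext <;> simp [← h]
    rw [hu, Complex.tan_mul_I, ← Complex.ofReal_tanh]
    simp
  · exact (re_tan_pos h h1).le

theorem norm_mul_cexp_neg_le {h : ℂ} {w : ℝ} (hw : 0 ≤ w) {z : ℂ} (hz : 0 ≤ z.re) :
    ‖h * Complex.exp (z * (-w : ℝ))‖ ≤ ‖h‖ := by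
  rw [norm_mul, norm_cexp_mul_ofReal]
  refine mul_le_of_le_one_right (norm_nonneg _) (Real.exp_le_one_iff.2 ?_)
  nlinarith

/-- If the boundary values of the Laplace transform of an integrable function vanish on an
interval, so does the transform itself. -/
theorem laplace_eq_zero {h : α → ℂ} {w : α → ℝ} (hh : Integrable h μ) (hw : AEMeasurable w μ)
    (hw0 : ∀ p, 0 ≤ w p) {ε : ℝ} (hε : 0 < ε)
    (hz : ∀ t : ℝ, |t| < ε → ∫ p, h p * Complex.exp ((t * Complex.I) * (-w p : ℝ)) ∂μ = 0) :
    ∫ p, h p * Complex.exp ((ε * Real.tan (1 / 2) : ℝ) * (-w p : ℝ)) ∂μ = 0 := by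
  set V : ℂ → ℂ := fun z => ∫ p, h p * Complex.exp (z * (-w p : ℝ)) ∂μ with hV
  have hmeas (z : ℂ) : AEStronglyMeasurable (fun p => h p * Complex.exp (z * (-w p : ℝ))) μ := by
    refine hh.1.mul (AEMeasurable.aestronglyMeasurable ?_)
    exact Complex.measurable_exp.comp_aemeasurable
      ((Complex.measurable_ofReal.comp_aemeasurable hw.neg).const_mul z)
  have hbound (z : ℂ) (hz : 0 ≤ z.re) : ‖V z‖ ≤ ∫ p, ‖h p‖ ∂μ :=
    norm_integral_le_of_norm_le hh.norm
      (Eventually.of_forall fun p => norm_mul_cexp_neg_le (hw0 p) hz)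
  have hcont : ContinuousOn V {z | 0 ≤ z.re} :=
    continuousOn_of_dominated (fun z _ => hmeas z)
      (fun z hz => Eventually.of_forall fun p => norm_mul_cexp_neg_le (hw0 p) hz) hh.norm
      (Eventually.of_forall fun p => by fun_prop)
  have hdiff (z : ℂ) (hz : 0 < z.re) : DifferentiableAt ℂ V z := by
    have hint (x : ℝ) (hx : 0 ≤ x) : Integrable (fun p => ‖h p‖ * Real.exp (x * -w p)) μ := by
      refine hh.norm.mono' (hh.1.norm.mul
        (Real.measurable_exp.comp_aemeasurable (hw.neg.const_mul x)).aestronglyMeasurable)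
        (Eventually.of_forall fun p => ?_)
      rw [norm_mul, norm_norm, Real.norm_eq_abs, Real.abs_exp]
      refine mul_le_of_le_one_right (norm_nonneg _) (Real.exp_le_one_iff.2 ?_)
      nlinarith [hw0 p]
    exact differentiableAt_laplace hh.1 hw.neg (half_pos hz) (hint _ (by linarith))
      (hint _ (by linarith))
  -- Since `tan (iy) = i tanh y`, the map `u ↦ ε tan u` sends the left edge of the strip into the
  -- segment `i(-ε, ε)` where `V` vanishes, and the rest into the right half-plane.
  set f : ℂ → ℂ := fun u => V (ε * Complex.tan u) with hf
  have hre (u : ℂ) : ((ε : ℂ) * Complex.tan u).re = ε * (Complex.tan u).re :=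
    Complex.re_ofReal_mul _ _
  have hstrip : DiffContOnCl ℂ f (Complex.HadamardThreeLines.verticalStrip 0 1) := by
    refine ⟨fun u hu => ?_, ?_⟩
    · have hu' : 0 < u.re ∧ u.re < 1 := hu
      have h1 := hdiff (ε * Complex.tan u) (by
        rw [hre]; exact mul_pos hε (re_tan_pos hu'.1 hu'.2.le))
      have h2 : DifferentiableAt ℂ (fun u => (ε : ℂ) * Complex.tan u) u :=
        (Complex.differentiableAt_tan.2 (cos_ne_zero_of_re hu'.1.le hu'.2.le)).const_mul _
      exact (DifferentiableAt.comp u h1 h2).differentiableWithinAt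
    · have hcl : closure (Complex.HadamardThreeLines.verticalStrip 0 1) ⊆
          Complex.HadamardThreeLines.verticalClosedStrip 0 1 :=
        closure_minimal (Set.preimage_mono Set.Ioo_subset_Icc_self)
          (isClosed_Icc.preimage Complex.continuous_re)
      refine ContinuousOn.mono ?_ hcl
      refine hcont.comp (fun u hu => ?_) fun u hu => ?_
      · have hu' : 0 ≤ u.re ∧ u.re ≤ 1 := hu
        exact ((Complex.continuousAt_tan.2
          (cos_ne_zero_of_re hu'.1 hu'.2)).const_mul _).continuousWithinAt
      · have hu' : 0 ≤ u.re ∧ u.re ≤ 1 := hu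
        rw [Set.mem_ofPred_eq, hre]
        exact mul_nonneg hε.le (re_tan_nonneg hu'.1 hu'.2)
  have hfb (u : ℂ) (hu : u ∈ Complex.HadamardThreeLines.verticalClosedStrip 0 1) :
      ‖f u‖ ≤ ∫ p, ‖h p‖ ∂μ := by
    have hu' : 0 ≤ u.re ∧ u.re ≤ 1 := hu
    refine hbound _ ?_
    rw [hre]
    exact mul_nonneg hε.le (re_tan_nonneg hu'.1 hu'.2)
  -- With bound `0` on the left edge, the three lines theorem at the midpoint gives the bound `0 ^
  -- (1/2)` times a constant.
  have key := Complex.HadamardThreeLines.norm_le_interp_of_mem_verticalClosedStrip₀₁' f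
    (z := (1 / 2 : ℝ)) (a := 0) (b := ∫ p, ‖h p‖ ∂μ)
    (by constructor <;> norm_num) hstrip
    ⟨_, by rintro _ ⟨u, hu, rfl⟩; exact hfb u hu⟩ (fun u hu => ?_)
    (fun u hu => hfb u (by
      have hu' : u.re = 1 := hu
      constructor <;> simp [hu']))
  · rw [Complex.ofReal_re, Real.zero_rpow (by norm_num), zero_mul] at key
    have h0 := norm_le_zero_iff.1 key
    rw [hf, hV] at h0
    simpa [Complex.ofReal_tan] using h0
  · have hu' : u = (u.im : ℂ) * Complex.I := by
      have : u.re = 0 := hu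
      apply Complex.ext <;> simp [this]
    have h0 := hz (ε * Real.tanh u.im) (by
      rw [abs_mul, abs_of_pos hε]
      exact mul_lt_of_lt_one_right hε (Real.abs_tanh_lt_one _))
    rw [hu', hf]
    simp only
    rw [Complex.tan_mul_I, ← Complex.ofReal_tanh, ← mul_assoc, ← Complex.ofReal_mul, hV]
    exact (congrArg norm h0).trans_le norm_zero.le

/-- If the Fourier transform of an exponentially decaying function vanishes on an interval, it
vanishes identically. -/
theorem fourier_eq_zero_of_exp_decay {h : α → ℂ} {a : α → ℝ} (hh : AEStronglyMeasurable h μ)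
    (ha : AEMeasurable a μ) {δ ε : ℝ} (hδ : 0 < δ) (hε : 0 < ε)
    (hint : ∀ x : ℝ, |x| ≤ δ → Integrable (fun p => ‖h p‖ * Real.exp (x * a p)) μ)
    (hz : ∀ t : ℝ, |t| < ε → ∫ p, h p * Complex.exp ((t * Complex.I) * a p) ∂μ = 0) (t : ℝ) :
    ∫ p, h p * Complex.exp ((t * Complex.I) * a p) ∂μ = 0 := by
  set F : ℂ → ℂ := fun z => ∫ p, h p * Complex.exp (z * a p) ∂μ with hF
  -- Half the available width, so that the exponents `re z ± δ / 2` stay within `[-δ, δ]`.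
  set U : Set ℂ := Complex.re ⁻¹' Set.Ioo (-(δ / 2)) (δ / 2) with hU
  have hUo : IsOpen U := isOpen_Ioo.preimage Complex.continuous_re
  have hUc : IsPreconnected U :=
    ((convex_Ioo (-(δ / 2)) (δ / 2)).linear_preimage Complex.reLm).isPreconnected
  have hd : DifferentiableOn ℂ F U := fun z hz => by
    have hz' : |z.re| < δ / 2 := abs_lt.2 hz
    refine (differentiableAt_laplace hh ha (half_pos hδ) (hint _ ?_)
      (hint _ ?_)).differentiableWithinAt
    · exact (abs_add_le _ _).trans (by rw [abs_of_pos (half_pos hδ)]; linarith)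
    · exact (abs_sub _ _).trans (by rw [abs_of_pos (half_pos hδ)]; linarith)
  have hmem (t : ℝ) : (t : ℂ) * Complex.I ∈ U := by
    simp [hU, hδ]
  -- The zeros on the imaginary axis accumulate at `0`, as the identity theorem requires.
  have hfreq : ∃ᶠ z in 𝓝[≠] (0 : ℂ), F z = 0 := by
    have ht : Tendsto (fun t : ℝ => (t : ℂ) * Complex.I) (𝓝[≠] 0) (𝓝[≠] 0) := by
      refine tendsto_nhdsWithin_of_tendsto_nhds_of_eventually_within _ ?_ ?_
      · have : Continuous fun t : ℝ => (t : ℂ) * Complex.I := by fun_prop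
        exact (this.tendsto' 0 0 (by simp)).mono_left nhdsWithin_le_nhds
      · filter_upwards [self_mem_nhdsWithin] with t ht
        simpa using ht
    refine ht.frequently (Eventually.frequently ?_)
    filter_upwards [nhdsWithin_le_nhds (Metric.ball_mem_nhds (0 : ℝ) hε)] with t ht
    exact hz t (by simpa using ht)
  exact (hd.analyticOnNhd hUo).eqOn_zero_of_preconnected_of_frequently_eq_zero hUc
    (by simpa using hmem 0) hfreq (hmem t)

end Laplace

/-- A function that is integrable for some locally finite measure is determined by its Fourier
transform. -/
theorem ae_eq_zero_of_fourier_eq_zero {V : Type*} [NormedAddCommGroup V] [InnerProductSpace ℝ V]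
    [FiniteDimensional ℝ V] [MeasurableSpace V] [BorelSpace V] {μ : Measure V} [SigmaFinite μ]
    {h : V → ℂ} (hh : Integrable h μ)
    (hz : ∀ y : V, ∫ p, h p * Complex.exp (Complex.I * (⟪p, y⟫_ℝ : ℝ)) ∂μ = 0) :
    h =ᵐ[μ] 0 := by
  refine ae_eq_zero_of_integral_contDiff_smul_eq_zero hh.locallyIntegrable fun g hg hgc => ?_
  have hg₁ : HasCompactSupport (Complex.ofRealCLM ∘ g) := hgc.comp_left rfl
  have hg₂ : ContDiff ℝ (⊤ : ℕ∞) (Complex.ofRealCLM ∘ g) := by fun_prop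
  set G : 𝓢(V, ℂ) := hg₁.toSchwartzMap hg₂
  set φ : 𝓢(V, ℂ) := FourierTransform.fourierInv G
  -- The multiplication formula: as `φ` has Fourier transform `g`, the integral of `g h` equals that
  -- of `φ` against the transform of `h`, which is zero.
  have key := VectorFourier.integral_fourierIntegral_smul_eq_flip (L := innerₗ V)
    (μ := (volume : Measure V)) (ν := μ) Real.continuous_fourierChar continuous_inner
    φ.integrable hh
  have e1 (ξ : V) : VectorFourier.fourierIntegral Real.fourierChar volume (innerₗ V) φ ξ =
      (g ξ : ℂ) := by
    have : FourierTransform.fourier φ = G := FourierTransform.fourier_fourierInv_eq G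
    exact congrArg (fun f : 𝓢(V, ℂ) => f ξ) this
  have e2 (x : V) : VectorFourier.fourierIntegral Real.fourierChar μ (innerₗ V).flip h x = 0 := by
    rw [← hz ((-(2 * Real.pi)) • x), VectorFourier.fourierIntegral]
    refine integral_congr_ae (Eventually.of_forall fun p => ?_)
    simp only [LinearMap.flip_apply, innerₗ_apply_apply, Circle.smul_def, Real.fourierChar_apply,
      inner_smul_right, smul_eq_mul, real_inner_comm]
    rw [mul_comm]
    congr 2
    push_cast
    ring
  simp only [e1, e2, smul_zero, integral_zero] at key
  simpa [Complex.real_smul] using key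

/-! ### The Reeh–Schlieder property in the one-particle space. -/

section OneParticle

variable {m : ℝ} {s : ℕ}

theorem norm_le_energy (p : Momentum s) : ‖p‖ ≤ energy m p :=
  Real.le_sqrt_of_sq_le (le_add_of_nonneg_right (sq_nonneg m))

theorem energy_nonneg (p : Momentum s) : 0 ≤ energy m p := Real.sqrt_nonneg _

/-- The event with time `t` and spatial position `y`. -/
def event {s : ℕ} (t : ℝ) (y : Momentum s) : Spacetime s :=
  WithLp.toLp 2 (Fin.cons t fun k : Fin s => y k)

theorem mdot_event (p : Momentum s) (t : ℝ) (y : Momentum s) :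
    mdot (shell m p) (event t y) = energy m p * t - ⟪p, y⟫_ℝ := by
  simp [mdot, shell, event, PiLp.inner_apply, mul_comm]

theorem norm_event_le (t : ℝ) (y : Momentum s) : ‖event t y‖ ≤ |t| + ‖y‖ := by
  refine (sq_le_sq₀ (norm_nonneg _) (by positivity)).1 ?_
  rw [EuclideanSpace.norm_sq_eq, Fin.sum_univ_succ]
  have : ∑ k : Fin s, ‖event t y k.succ‖ ^ 2 = ‖y‖ ^ 2 := by
    rw [EuclideanSpace.norm_sq_eq]
    simp [event]
  rw [this]
  simp only [event, Fin.cons_zero, Real.norm_eq_abs]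
  nlinarith [abs_nonneg t, norm_nonneg y]

/-- An integrable function on the mass shell whose Fourier transform vanishes near the origin of
Minkowski space is zero. -/
theorem ae_eq_zero_of_local_fourier {h : Momentum s → ℂ} (hh : Integrable h (shellMeasure m s))
    {r : ℝ} (hr : 0 < r) (hz : ∀ a : Spacetime s, ‖a‖ < r →
      ∫ p, h p * Complex.exp (Complex.I * (mdot (shell m p) a : ℝ)) ∂shellMeasure m s = 0) :
    h =ᵐ[shellMeasure m s] 0 := by
  have hr2 := half_pos hr
  -- The imaginary time reached by `laplace_eq_zero` from the interval `|t| < r / 2`; the other half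
  -- of the radius is left for the spatial translation.
  set τ : ℝ := r / 2 * Real.tan (1 / 2) with hτ
  have hτ0 : 0 < τ := mul_pos hr2 (Real.tan_pos_of_pos_of_lt_pi_div_two (by norm_num)
    (by linarith [Real.pi_gt_three]))
  have hωm : AEMeasurable (energy m : Momentum s → ℝ) (shellMeasure m s) := by
    have : Continuous (energy m : Momentum s → ℝ) := continuous_energy
    exact this.aemeasurable
  have hphase (y : Momentum s) : Continuous fun p : Momentum s =>
      Complex.exp (-Complex.I * (⟪p, y⟫_ℝ : ℝ)) := by fun_prop
  have hnphase (p y : Momentum s) : ‖Complex.exp (-Complex.I * (⟪p, y⟫_ℝ : ℝ))‖ = 1 := by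
    rw [norm_cexp_mul_ofReal]
    simp
  have step1 (y : Momentum s) (hy : ‖y‖ < r / 2) :
      ∫ p, (h p * Complex.exp (τ * (-energy m p : ℝ))) *
        Complex.exp (-Complex.I * (⟪p, y⟫_ℝ : ℝ)) ∂shellMeasure m s = 0 := by
    have hy1 : Integrable (fun p => h p * Complex.exp (-Complex.I * (⟪p, y⟫_ℝ : ℝ)))
        (shellMeasure m s) := by
      refine hh.norm.mono' (hh.1.mul (hphase y).aestronglyMeasurable)
        (Eventually.of_forall fun p => ?_)
      rw [norm_mul, hnphase, mul_one]
    have key := laplace_eq_zero hy1 hωm (energy_nonneg (m := m)) hr2 fun t ht => by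
      -- The Laplace exponent carries `-ω`, hence time `-t`.
      rw [← hz (event (-t) y) ((norm_event_le _ _).trans_lt (by rw [abs_neg]; linarith))]
      refine integral_congr_ae (Eventually.of_forall fun p => ?_)
      simp only [mdot_event]
      rw [mul_assoc, ← Complex.exp_add]
      congr 2
      push_cast
      ring
    rw [← key]
    refine integral_congr_ae (Eventually.of_forall fun p => ?_)
    simp only [← hτ]
    ring
  have hexp : Continuous fun p : Momentum s => Complex.exp (τ * (-energy m p : ℝ)) := by
    have : Continuous (energy m : Momentum s → ℝ) := continuous_energy
    fun_prop
  have hh' : Integrable (fun p => h p * Complex.exp (τ * (-energy m p : ℝ)))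
      (shellMeasure m s) :=
    hh.norm.mono' (hh.1.mul hexp.aestronglyMeasurable) (Eventually.of_forall fun p =>
      norm_mul_cexp_neg_le (energy_nonneg p) (by simpa using hτ0.le))
  -- As `‖p‖ ≤ ω_p`, the factor `e^{-τω}` dominates `e^{x⟨p, y⟩}` for `|x| (‖y‖ + 1) ≤ τ`; the `+ 1`
  -- avoids division by zero at `y = 0`. The transform along the line through `y` vanishes for small
  -- `t`, and is then evaluated at `t = 1`.
  have hzero := ae_eq_zero_of_fourier_eq_zero hh' fun y => by
    have hy0 : 0 < ‖y‖ + 1 := by positivity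
    have ham : Continuous fun p : Momentum s => ⟪p, y⟫_ℝ := by fun_prop
    have hδ : 0 < τ / (‖y‖ + 1) := div_pos hτ0 hy0
    have hε : 0 < r / 2 / (‖y‖ + 1) := div_pos hr2 hy0
    have key := fourier_eq_zero_of_exp_decay hh'.1 ham.aemeasurable hδ hε (fun x hx => ?_)
      (fun t ht => ?_) 1
    · rw [← key]
      refine integral_congr_ae (Eventually.of_forall fun p => ?_)
      simp
    · refine hh.norm.mono' (hh'.1.norm.mul (Continuous.aestronglyMeasurable (by fun_prop)))
        (Eventually.of_forall fun p => ?_)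
      have hn : ‖Complex.exp ((τ : ℂ) * (-energy m p : ℝ))‖ = Real.exp (τ * -energy m p) :=
        norm_cexp_mul_ofReal _ _
      rw [norm_mul, norm_norm, Real.norm_eq_abs, Real.abs_exp, norm_mul, hn, mul_assoc,
        ← Real.exp_add]
      refine mul_le_of_le_one_right (norm_nonneg _) (Real.exp_le_one_iff.2 ?_)
      have h1 : |x| * (‖y‖ + 1) ≤ τ := (le_div_iff₀ hy0).1 hx
      have h2 : x * ⟪p, y⟫_ℝ ≤ |x| * (energy m p * ‖y‖) :=
        (le_abs_self _).trans ((abs_mul _ _).trans_le (mul_le_mul_of_nonneg_left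
          ((abs_real_inner_le_norm p y).trans (mul_le_mul_of_nonneg_right (norm_le_energy p)
            (norm_nonneg y))) (abs_nonneg x)))
      have h3 := mul_le_mul_of_nonneg_right h1 (energy_nonneg (m := m) p)
      nlinarith [mul_nonneg (abs_nonneg x) (energy_nonneg (m := m) p)]
    · have h1 : ‖-t • y‖ < r / 2 := by
        have h := (lt_div_iff₀ hy0).1 ht
        rw [norm_smul, Real.norm_eq_abs, abs_neg]
        nlinarith [abs_nonneg t]
      rw [← step1 _ h1]
      refine integral_congr_ae (Eventually.of_forall fun p => ?_)
      simp only [inner_smul_right]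
      congr 2
      push_cast
      ring
  filter_upwards [hzero] with p hp
  exact (mul_eq_zero.1 hp).resolve_right (Complex.exp_ne_zero _)

theorem tsupport_translate_subset (f : 𝓢(Spacetime s, ℂ)) (a : Spacetime s)
    {O : Set (Spacetime s)} (h : ∀ x ∈ tsupport f, x + a ∈ O) :
    tsupport (SchwartzMap.compSubConstCLM ℂ a f) ⊆ O := by
  have e : (SchwartzMap.compSubConstCLM ℂ a f : Spacetime s → ℂ) =
      f ∘ (Homeomorph.subRight a) := by
    funext x
    simp
  rw [e, tsupport_comp_eq_preimage]
  intro x hx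
  simpa using h _ hx

/-- Near any event there are test functions for which `f⁺` does not vanish at a given momentum. -/
theorem exists_testPlus_ne_zero (x₀ : Spacetime s) {r : ℝ} (hr : 0 < r) (p : Momentum s) :
    ∃ f : 𝓢(Spacetime s, ℂ), tsupport f ⊆ Metric.closedBall x₀ r ∧ testPlus m f p ≠ 0 := by
  let φ : ContDiffBump x₀ := ⟨r / 2, r, half_pos hr, half_lt_self hr⟩
  -- A bump function times the conjugate plane wave, so that `f⁺(p)` is the positive integral of the
  -- bump.
  set F : Spacetime s → ℂ := fun x =>
    (φ x : ℂ) * Complex.exp (-(Complex.I * (mdot (shell m p) x : ℝ))) with hF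
  have hmd : ContDiff ℝ (⊤ : ℕ∞) fun x : Spacetime s => (mdot (shell m p) x : ℂ) := by
    have h : ContDiff ℝ (⊤ : ℕ∞) fun x : Spacetime s => mdot (shell m p) x := by
      simp only [← inner_coshell]
      exact contDiff_id.inner ℝ contDiff_const
    exact Complex.ofRealCLM.contDiff.comp h
  have hφ : ContDiff ℝ (⊤ : ℕ∞) fun x : Spacetime s => (φ x : ℂ) :=
    Complex.ofRealCLM.contDiff.comp φ.contDiff
  have hFs : ContDiff ℝ (⊤ : ℕ∞) F := hφ.mul (contDiff_const.mul hmd).neg.cexp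
  have hφc : HasCompactSupport fun x : Spacetime s => (φ x : ℂ) :=
    φ.hasCompactSupport.comp_left (g := fun x : ℝ => (x : ℂ)) rfl
  have hFc : HasCompactSupport F := hφc.mul_right
  refine ⟨hFc.toSchwartzMap hFs, ?_, ?_⟩
  · refine (tsupport_mul_subset_left (f := fun x => (φ x : ℂ))).trans ?_
    refine (closure_mono fun x hx => ?_).trans φ.tsupport_eq.subset
    exact fun h => hx (by simp [h])
  · have e : testPlus m (hFc.toSchwartzMap hFs) p = ∫ x, (φ x : ℂ) := by
      refine integral_congr_ae (Eventually.of_forall fun x => ?_)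
      simp [hF, mul_assoc, ← Complex.exp_add]
    rw [e, integral_complex_ofReal]
    exact Complex.ofReal_ne_zero.2 φ.integral_pos.ne'

/-- The Reeh–Schlieder property of the one-particle space. -/
theorem eq_zero_of_forall_inner_testPlusL (hm : 0 < m) {O : Set (Spacetime s)} (hO : IsOpen O)
    (hne : O.Nonempty) {A : Lp ℂ 2 (shellMeasure m s)}
    (h : ∀ f : 𝓢(Spacetime s, ℂ), tsupport f ⊆ O → ⟪A, testPlusL hm s f⟫_ℂ = 0) : A = 0 := by
  obtain ⟨x₀, hx₀⟩ := hne
  obtain ⟨r, hr, hball⟩ := Metric.isOpen_iff.1 hO x₀ hx₀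
  have key (f : 𝓢(Spacetime s, ℂ)) (hf : tsupport f ⊆ Metric.closedBall x₀ (r / 2)) :
      ∀ᵐ p ∂shellMeasure m s, star (A p) * testPlus m f p = 0 := by
    have hint : Integrable (fun p => star (A p) * testPlus m f p) (shellMeasure m s) := by
      refine (L2.integrable_inner A (testPlusL hm s f)).congr ?_
      filter_upwards [coeFn_testPlusL hm f] with p hp
      rw [hp, RCLike.inner_apply, mul_comm]
      rfl
    -- Support within `r / 2` and translations shorter than `r / 2` stay inside the ball contained
    -- in `O`.
    refine ae_eq_zero_of_local_fourier hint (half_pos hr) fun a ha => ?_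
    have h1 := h (SchwartzMap.compSubConstCLM ℂ a f) (tsupport_translate_subset f a fun x hx =>
      hball (by
        have h2 := hf hx
        rw [Metric.mem_closedBall, dist_eq_norm] at h2
        rw [Metric.mem_ball, dist_eq_norm, add_sub_right_comm]
        exact (norm_add_le _ _).trans_lt (by linarith)))
    rw [L2.inner_def] at h1
    rw [← h1]
    refine integral_congr_ae ?_
    filter_upwards [coeFn_testPlusL hm (SchwartzMap.compSubConstCLM ℂ a f)] with p hp
    rw [hp, testPlus_translate, RCLike.inner_apply]
    simp only [starRingEnd_apply]
    ring
  rw [Lp.eq_zero_iff_ae_eq_zero]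
  -- The test function depends on the momentum: by continuity `f⁺` is non-zero near `p`, which
  -- forces `A` to vanish almost everywhere there.
  refine measure_null_of_locally_null _ fun p _ => ?_
  obtain ⟨f, hf, hfp⟩ := exists_testPlus_ne_zero (m := m) x₀ (half_pos hr) p
  refine ⟨{q | testPlus m f q ≠ 0} ∩ {q | ¬ A q = 0}, ?_, ?_⟩
  · rw [Set.inter_comm]
    exact inter_mem self_mem_nhdsWithin (mem_nhdsWithin_of_mem_nhds
      ((continuous_testPlus hm f).continuousAt.eventually_ne hfp))
  · refine measure_mono_null ?_ (key f hf)
    rintro q ⟨hq, hA⟩ h0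
    exact (mul_ne_zero (star_ne_zero.2 hA) hq) h0

end OneParticle

/-! ### The field on finite particle vectors. -/

section Field

variable {m : ℝ} {s : ℕ} {Q : Matrix (Fin (s + 1)) (Fin (s + 1)) ℝ}

theorem isBandImage_field (hm : 0 < m) (hQ : Q.transpose = -Q) (f : 𝓢(Spacetime s, ℂ))
    (Ψ : (field m Q f).domain) :
    IsBandImage (fun n => creationBlock Q m n (testPlusL hm s f))
      (fun n => annihilationBlock Q m n (testMinusL hm s f)) (Ψ : Fock m s) (field m Q f Ψ) :=
  isBandImage_creation_add_annihilation hQ (coeFn_testPlusL hm f) (coeFn_testMinusL hm f) Ψ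

theorem mem_domain_field (hm : 0 < m) (hQ : Q.transpose = -Q) (f : 𝓢(Spacetime s, ℂ))
    {Ψ : Fock m s} (hΨ : Ψ ∈ finiteParticle m s) : Ψ ∈ (field m Q f).domain := by
  obtain ⟨N, hN⟩ := hΨ
  exact mem_domain_creation_add_annihilation hQ (coeFn_testPlusL hm f) (coeFn_testMinusL hm f) hN

theorem single_mem_finiteParticle (n : ℕ) (x : nParticle m s n) :
    lp.single 2 n x ∈ finiteParticle m s :=
  ⟨n + 1, fun k hk => lp.single_apply_ne _ _ _ (by omega)⟩

theorem dense_finiteParticle (m : ℝ) (s : ℕ) : Dense (finiteParticle m s : Set (Fock m s)) :=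
  dense_of_single_mem _ single_mem_finiteParticle

theorem field_mem_finiteParticle (hm : 0 < m) (hQ : Q.transpose = -Q) (f : 𝓢(Spacetime s, ℂ))
    (Ψ : (field m Q f).domain) (hΨ : (Ψ : Fock m s) ∈ finiteParticle m s) :
    field m Q f Ψ ∈ finiteParticle m s := by
  obtain ⟨N, hN⟩ := hΨ
  exact ⟨N + 1, (isBandImage_field hm hQ f Ψ).eq_zero_of_le hN⟩

/-- The vector-valued distribution `f ↦ φ(Q, f)Ψ`, for `Ψ` with fewer than `N` particles. -/
def fieldDistribution (hm : 0 < m) (Q : Matrix (Fin (s + 1)) (Fin (s + 1)) ℝ) (Ψ : Fock m s)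
    (N : ℕ) : 𝓢(Spacetime s, ℂ) →L[ℂ] Fock m s :=
  ∑ n ∈ Finset.range N,
      (lp.singleContinuousLinearMap ℂ (fun n => nParticle m s n) 2 (n + 1)) ∘L
        ((creationBlock Q m n).flip (Ψ n)) ∘L testPlusL hm s +
    ∑ n ∈ Finset.range N,
      (lp.singleContinuousLinearMap ℂ (fun n => nParticle m s n) 2 n) ∘L
        ((annihilationBlock Q m n).flip (Ψ (n + 1))) ∘L testMinusL hm s

theorem fieldDistribution_apply (hm : 0 < m) (hQ : Q.transpose = -Q) (f : 𝓢(Spacetime s, ℂ))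
    (Ψ : (field m Q f).domain) {N : ℕ} (hN : ∀ n, N ≤ n → (Ψ : Fock m s) n = 0) :
    field m Q f Ψ = fieldDistribution hm Q (Ψ : Fock m s) N f := by
  have h := (isBandImage_field hm hQ f Ψ).ext (isBandImage_sumRaise_add_sumLower hN)
  rw [h, fieldDistribution, add_apply, sum_apply, sum_apply]
  rfl

/-- Conjugating `f` exchanges `f⁺` and `f⁻` up to conjugation, so the blocks of the two fields are
mutually adjoint. The pairing is checked on the full domain of the field, not only on `𝒟`. -/
theorem exists_adjoint_field_eq (hm : 0 < m) (hQ : Q.transpose = -Q) (f : 𝓢(Spacetime s, ℂ))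
    {Ψ : Fock m s} (hΨ : Ψ ∈ finiteParticle m s) :
    ∃ (h : Ψ ∈ (field m Q f).adjoint.domain) (h' : Ψ ∈ (field m Q (conjTest f)).domain),
      (field m Q f).adjoint ⟨Ψ, h⟩ = field m Q (conjTest f) ⟨Ψ, h'⟩ := by
  have hd : Dense ((field m Q f).domain : Set (Fock m s)) :=
    (dense_finiteParticle m s).mono fun _ => mem_domain_field hm hQ f
  have h' := mem_domain_field hm hQ (conjTest f) hΨ
  obtain ⟨N, hN⟩ := hΨ
  have key (Φ : (field m Q f).domain) :
      ⟪field m Q (conjTest f) ⟨Ψ, h'⟩, (Φ : Fock m s)⟫_ℂ = ⟪Ψ, field m Q f Φ⟫_ℂ := by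
    refine IsBandImage.inner_eq_inner (fun n x y => ?_) (fun n x y => ?_)
      (isBandImage_field hm hQ (conjTest f) ⟨Ψ, h'⟩) (isBandImage_field hm hQ f Φ) hN
    · rw [← star_testMinusL]
      have h := inner_creationBlock Q (star (testMinusL hm s f)) x y
      rwa [star_star] at h
    · rw [← star_testPlusL]
      have h := inner_annihilationBlock Q (star (testPlusL hm s f)) x y
      rwa [star_star] at h
  have h : Ψ ∈ (field m Q f).adjoint.domain :=
    LinearPMap.mem_adjoint_domain_of_exists _ ⟨_, key⟩
  exact ⟨h, h', LinearPMap.adjoint_apply_eq hd ⟨Ψ, h⟩ key⟩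

theorem conjTest_eq_self {f : 𝓢(Spacetime s, ℂ)} (hf : ∀ x, (f x).im = 0) : conjTest f = f := by
  ext x
  rw [conjTest_apply]
  exact Complex.conj_eq_iff_im.2 (hf x)

theorem essentiallySelfAdjointOn_field (hm : 0 < m) (hQ : Q.transpose = -Q)
    {f : 𝓢(Spacetime s, ℂ)} (hf : ∀ x, (f x).im = 0) :
    EssentiallySelfAdjointOn (field m Q f) (finiteParticle m s) := by
  have hle : finiteParticle m s ≤ (field m Q f).domain := fun _ => mem_domain_field hm hQ f
  have hstar : star (testPlusL hm s f) = testMinusL hm s f := by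
    rw [star_testPlusL, conjTest_eq_self hf]
  have hnorm : ‖testMinusL hm s f‖ = ‖testPlusL hm s f‖ := by rw [← hstar, norm_Lp_star]
  refine ⟨hle, isSelfAdjoint_closure_of_isBandImage (norm_nonneg (testPlusL hm s f))
    (C := fun n => creationBlock Q m n (testPlusL hm s f))
    (A := fun n => annihilationBlock Q m n (testMinusL hm s f))
    (fun n x => norm_creationBlock_le Q _ x) (fun n x => ?_) (fun n x y => ?_) (fun Ψ => ?_)
    (fun Ψ => Ψ.2.1) fun n x => ⟨single_mem_finiteParticle n x,
      hle (single_mem_finiteParticle n x)⟩⟩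
  · rw [← hnorm]
    exact norm_annihilationBlock_le Q _ x
  · rw [← hstar]
    exact inner_creationBlock Q _ x y
  · exact isBandImage_field hm hQ f ⟨Ψ, Ψ.2.2⟩

end Field

/-! ### The Reeh–Schlieder property in Fock space. -/

section ReehSchlieder

variable {m : ℝ} {s : ℕ} {Q : Matrix (Fin (s + 1)) (Fin (s + 1)) ℝ}

theorem integral_shellMeasurePi_zero (F : (Fin 0 → Momentum s) → ℂ) :
    ∫ q, F q ∂shellMeasurePi m s 0 = F fun i => i.elim0 := by
  rw [shellMeasurePi, Measure.pi_of_empty _ fun i => i.elim0, integral_dirac]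

/-- The space of `0`-tuples is a point of mass one, so pairing with the vacuum evaluates the wave
function there. -/
theorem eq_zero_of_inner_vacuum {Φ : Fock m s} (h : ⟪vacuum m s, Φ⟫_ℂ = 0) : Φ 0 = 0 := by
  rw [vacuum, lp.inner_single_left, Submodule.coe_inner, L2.inner_def] at h
  have h1 : ∫ q, (Φ 0 : Lp ℂ 2 (shellMeasurePi m s 0)) q ∂shellMeasurePi m s 0 = 0 := by
    rw [← h]
    refine integral_congr_ae ?_
    filter_upwards [(memLp_one_zero m s).coeFn_toLp] with q hq
    simp only [RCLike.inner_apply]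
    rw [hq, map_one, mul_one]
  rw [integral_shellMeasurePi_zero] at h1
  rw [← Submodule.coe_eq_zero, Lp.eq_zero_iff_ae_eq_zero]
  refine Eventually.of_forall fun q => ?_
  rw [Subsingleton.elim q fun i => i.elim0]
  exact h1

/-- An `(n+1)`-particle vector annihilated by `a(Q, conj f⁺)` for all test functions `f` supported
in `O` vanishes. -/
theorem eq_zero_of_local_annihilationBlock (hm : 0 < m) {O : Set (Spacetime s)} (hO : IsOpen O)
    (hne : O.Nonempty) {n : ℕ} {Φ : nParticle m s (n + 1)}
    (h : ∀ f : 𝓢(Spacetime s, ℂ), tsupport f ⊆ O →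
      annihilationBlock Q m n (star (testPlusL hm s f)) Φ = 0) : Φ = 0 := by
  refine eq_zero_of_forall_annihilationBlock Q fun g => ?_
  refine ext_inner_right ℂ fun ψ => ?_
  have h1 := inner_annihilationBlock Q g Φ ψ
  refine h1.trans (Eq.trans ?_ (inner_zero_left ψ).symm)
  -- `g ↦ ⟪Φ, a*(Q, g)ψ⟫` is a bounded linear functional. Its Riesz vector `A` is orthogonal to
  -- every localized `f⁺`, hence zero.
  set L : Lp ℂ 2 (shellMeasure m s) →L[ℂ] ℂ :=
    (innerSL ℂ Φ) ∘L ((creationBlock Q m n).flip ψ) with hL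
  set A := (InnerProductSpace.toDual ℂ (Lp ℂ 2 (shellMeasure m s))).symm L with hA
  have hLA (g : Lp ℂ 2 (shellMeasure m s)) : ⟪A, g⟫_ℂ = L g :=
    InnerProductSpace.toDual_symm_apply
  have hA0 : A = 0 := eq_zero_of_forall_inner_testPlusL hm hO hne fun f hf => by
    have h1 := inner_annihilationBlock Q (star (testPlusL hm s f)) Φ ψ
    rw [h f hf, star_star] at h1
    exact (hLA _).trans (h1.symm.trans (inner_zero_left ψ))
  have h2 := hLA (star g)
  rw [hA0, inner_zero_left] at h2
  exact h2.symm

/-- `Φ` starts in degree `n + 1` and `φ(Q, f)Ψ` ends there, so only this degree contributes; in it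
the annihilation part is absent because `Ψ` has no component in degree `n + 2`. -/
theorem inner_single_annihilationBlock (hm : 0 < m) (hQ : Q.transpose = -Q)
    (f : 𝓢(Spacetime s, ℂ)) {n : ℕ} {Φ : Fock m s} (hΦ : ∀ k ≤ n, Φ k = 0)
    (Ψ : (field m Q f).domain) (hΨ : ∀ k, n < k → (Ψ : Fock m s) k = 0) :
    ⟪(lp.single 2 n (annihilationBlock Q m n (star (testPlusL hm s f)) (Φ (n + 1))) : Fock m s),
      (Ψ : Fock m s)⟫_ℂ = ⟪Φ, field m Q f Ψ⟫_ℂ := by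
  have hb := isBandImage_field hm hQ f Ψ
  have hvan : ∀ k, n + 2 ≤ k → field m Q f Ψ k = 0 := hb.eq_zero_of_le (N := n + 1) hΨ
  have hlast : field m Q f Ψ (n + 1) =
      creationBlock Q m n (testPlusL hm s f) ((Ψ : Fock m s) n) := by
    have h2 := hb.2 n
    have h3 : annihilationBlock Q m (n + 1) (testMinusL hm s f) ((Ψ : Fock m s) (n + 2)) = 0 := by
      rw [hΨ (n + 2) (by omega), map_zero]
    exact h2.trans ((congrArg _ h3).trans (add_zero _))
  have hadj := inner_annihilationBlock Q (star (testPlusL hm s f)) (Φ (n + 1)) ((Ψ : Fock m s) n)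
  rw [star_star, ← hlast] at hadj
  have hsum := inner_eq_sum_range hvan Φ
  rw [Finset.sum_range_succ, Finset.sum_eq_zero fun k hk => by
    rw [hΦ k (by simpa [Nat.lt_succ_iff] using hk), inner_zero_right], zero_add] at hsum
  rw [lp.inner_single_left]
  refine hadj.trans ?_
  have h5 : (starRingEnd ℂ) ⟪field m Q f Ψ (n + 1), Φ (n + 1)⟫_ℂ =
      ⟪Φ (n + 1), field m Q f Ψ (n + 1)⟫_ℂ := inner_conj_symm _ _
  have h4 := congrArg (starRingEnd ℂ) hsum
  rw [inner_conj_symm, h5] at h4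
  exact h4.symm

/-- A vector orthogonal to the field monomials with at most `n` particles has no components with
at most `n` particles. -/
theorem eq_zero_of_forall_inner_monomial (hm : 0 < m) (hQ : Q.transpose = -Q)
    {O : Set (Spacetime s)} (hO : IsOpen O) (hne : O.Nonempty) (n : ℕ) {Φ : Fock m s}
    (h : ∀ Ψ, IsFieldMonomial m Q O Ψ → (∀ k, n < k → Ψ k = 0) → ⟪Φ, Ψ⟫_ℂ = 0) :
    ∀ k ≤ n, Φ k = 0 := by
  induction n generalizing Φ with
  | zero =>
    intro k hk
    obtain rfl : k = 0 := by omega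
    refine eq_zero_of_inner_vacuum ?_
    have h0 := h _ IsFieldMonomial.vacuum fun k hk =>
      lp.single_apply_ne _ _ _ (by omega)
    rw [← inner_conj_symm, h0, map_zero]
  | succ n ih =>
    have hlow : ∀ k ≤ n, Φ k = 0 := ih fun Ψ hΨ hk => h Ψ hΨ fun k hk' => hk k (by omega)
    intro k hk
    rcases Nat.lt_or_eq_of_le hk with hk | rfl
    · exact hlow k (by omega)
    refine eq_zero_of_local_annihilationBlock (Q := Q) hm hO hne fun f hf => ?_
    -- The induction hypothesis is applied to the lowered vector: its pairing with a monomial `Ψ` of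
    -- at most `n` particles equals that of `Φ` with the monomial `φ(Q, f)Ψ`, which has at most `n +
    -- 1`.
    have h0 := ih (Φ := lp.single 2 n
      (annihilationBlock Q m n (star (testPlusL hm s f)) (Φ (n + 1)))) (fun Ψ hΨ hk => ?_) n le_rfl
    · rwa [lp.single_apply_self] at h0
    · have hdom := mem_domain_field hm hQ f ⟨n + 1, hk⟩
      rw [inner_single_annihilationBlock hm hQ f hlow ⟨Ψ, hdom⟩ hk]
      exact h _ (IsFieldMonomial.apply f hf ⟨Ψ, hdom⟩ hΨ)
        ((isBandImage_field hm hQ f ⟨Ψ, hdom⟩).eq_zero_of_le (N := n + 1) hk)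

theorem dense_span_fieldMonomial (hm : 0 < m) (hQ : Q.transpose = -Q)
    {O : Set (Spacetime s)} (hO : IsOpen O) (hne : O.Nonempty) :
    Dense (Submodule.span ℂ {Ψ : Fock m s | IsFieldMonomial m Q O Ψ} : Set (Fock m s)) := by
  rw [Submodule.dense_iff_topologicalClosure_eq_top, Submodule.topologicalClosure_eq_top_iff,
    Submodule.eq_bot_iff]
  intro Φ hΦ
  apply lp.ext
  funext n
  refine eq_zero_of_forall_inner_monomial hm hQ hO hne n (fun Ψ hΨ _ => ?_) n le_rfl
  rw [← inner_conj_symm, (Submodule.mem_orthogonal _ _).1 hΦ Ψ (Submodule.subset_span hΨ), map_zero]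

end ReehSchlieder

end

end TwistedField

theorem mainTheorem4 (s : ℕ) (hs : 1 ≤ s) (m : ℝ) (hm : 0 < m)
    (Q : Matrix (Fin (s + 1)) (Fin (s + 1)) ℝ) (hQ : Q.transpose = -Q) :
    -- the finite particle vectors are a dense invariant domain
    (Dense (finiteParticle m s : Set (Fock m s)) ∧
      ∀ f : 𝓢(Spacetime s, ℂ), finiteParticle m s ≤ (field m Q f).domain ∧
        ∀ Ψ : (field m Q f).domain, (Ψ : Fock m s) ∈ finiteParticle m s →
          field m Q f Ψ ∈ finiteParticle m s) ∧
    -- the map `f ↦ φ(Q, f)Ψ` is a vector-valued tempered distribution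
    (∀ Ψ ∈ finiteParticle m s, ∃ T : 𝓢(Spacetime s, ℂ) →L[ℂ] Fock m s,
      ∀ f : 𝓢(Spacetime s, ℂ), ∃ h : Ψ ∈ (field m Q f).domain, field m Q f ⟨Ψ, h⟩ = T f) ∧
    -- the adjoint on finite particle vectors, and essential self-adjointness
    (∀ f : 𝓢(Spacetime s, ℂ), ∀ Ψ ∈ finiteParticle m s,
      ∃ (h : Ψ ∈ (field m Q f).adjoint.domain) (h' : Ψ ∈ (field m Q (conjTest f)).domain),
        (field m Q f).adjoint ⟨Ψ, h⟩ = field m Q (conjTest f) ⟨Ψ, h'⟩) ∧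
    (∀ f : 𝓢(Spacetime s, ℂ), (∀ x, (f x).im = 0) →
      EssentiallySelfAdjointOn (field m Q f) (finiteParticle m s)) ∧
    -- the Reeh-Schlieder property
    (∀ O : Set (Spacetime s), IsOpen O → O.Nonempty →
      Dense (Submodule.span ℂ {Ψ : Fock m s | IsFieldMonomial m Q O Ψ} : Set (Fock m s))) := by
  exact ⟨⟨dense_finiteParticle m s, fun f => ⟨fun _ => mem_domain_field hm hQ f,
      field_mem_finiteParticle hm hQ f⟩⟩,
    fun Ψ ⟨N, hN⟩ => ⟨fieldDistribution hm Q Ψ N, fun f =>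
      ⟨mem_domain_field hm hQ f ⟨N, hN⟩, fieldDistribution_apply hm hQ f ⟨Ψ, _⟩ hN⟩⟩,
    fun f _ hΨ => exists_adjoint_field_eq hm hQ f hΨ,
    fun _ hf => essentiallySelfAdjointOn_field hm hQ hf,
    fun _ hO hne => dense_span_fieldMonomial hm hQ hO hne⟩
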